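/- Conventions. A residual chain in a group $\Gamma$ is a nested sequence $\Gamma=\Lambda_0\ge\Lambda_1\ge\cdots$ of finite index normal subgroups with $\bigcap_i\Lambda_i=\{1\}$; $\Gamma$ is residually finite if it admits a residual chain. The group $\Gamma$ is amenable if it satisfies the Følner condition: for every finite $S\subset\Gamma$ and every $\varepsilon>0$ there is a non-empty finite $F\subset\Gamma$ with $\#\{\gamma\in F\mid \gamma s\notin F\text{ for some }s\in S\}\le\varepsilon\,\#F$. It is of type $\mathsf{FP}_n$ if the trivial $\mathbb{Z}\Gamma$-module $\mathbb{Z}$ admits a projective resolution that is finitely generated in all degrees $\le n$. A chain complex is based free if each chain module is endowed with a basis; homomorphisms $f$ of based free $\mathbb{Z}$-modules have an operator norm $\|f\|$ with respect to the $\ell^1$-norms of the bases. Let $n\in\mathbb{N}$, $T,\kappa\in\mathbb{R}_{\ge1}$, and let $X$ be a based free $\mathbb{Z}$-chain complex concentrated in degrees $\ge 0$ with $X_j$ finitely generated for all $j\le n$. A weak $n$-rebuilding of $X$ of quality $(T,\kappa)$ consists of a based free $\mathbb{Z}$-chain complex $X'$ in degrees $\ge0$ with $X'_j$ finitely generated for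 all $j\le n$, chain maps $\xi\colon X\to X'$ and $\xi'\colon X'\to X$, and a chain homotopy $\operatorname{id}_X\simeq\xi'\circ\xi$, such that for all $j\le n$ $$\operatorname{rk}_{\mathbb{Z}}(X'_j)\le\kappa T^{-1}\operatorname{rk}_{\mathbb{Z}}(X_j),\qquad \|\partial^{X'}_j\|\le\exp(\kappa)T^{\kappa},\qquad \|\xi_j\|\le\exp(\kappa)T^{\kappa}.$$ For a subgroup $\Lambda\le\Gamma$ and a based free $\mathbb{Z}\Gamma$-chain complex $X$, let $X_\Lambda=\mathbb{Z}\otimes_{\mathbb{Z}\Lambda}X$ be the complex of $\Lambda$-coinvariants with the induced $\mathbb{Z}$-bases, consisting of the classes of all $\gamma e$ with $e$ a basis element and $\gamma\in\Gamma$. The class $\mathsf{CWR}_n$ consists of all residually finite groups $\Gamma$ for which the trivial $\mathbb{Z}\Gamma$-module $\mathbb{Z}$ admits a based free resolution $X$ such that $X_j$ is finitely generated over $\mathbb{Z}\Gamma$ for all $j\le n$ and the following holds: there exists $\kappa\in\mathbb{R}_{\ge1}$ such that for all $T\in\mathbb{R}_{\ge1}$ and all residual chains $\Lambda_*$ in $\Gamma$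 there exists $i_0\in\mathbb{N}$ such that for all $i\ge i_0$ the complex $X_{\Lambda_i}$ admits a weak $n$-rebuilding of quality $(T,\kappa)$. Theorem. Let $n\in\mathbb{N}$ and let $\Gamma$ be a residually finite infinite amenable group of type $\mathsf{FP}_n$. Then $\Gamma\in\mathsf{CWR}_n$. -/

import Mathlib

open CategoryTheory
open scoped NNReal ENNReal

universe u v w

noncomputable section

namespace CheapRebuilding

/-! ### Groups: residual chains and amenability -/

/-- A residual chain in `Γ`: a nested sequence `Γ = Λ₀ ≥ Λ₁ ≥ ⋯` of finite index normal
subgroups with trivial intersection. -/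
structure ResidualChain (Γ : Type u) [Group Γ] where
  /-- the subgroups of the chain -/
  subgroup : ℕ → Subgroup Γ
  zero_eq_top : subgroup 0 = ⊤
  antitone : Antitone subgroup
  normal : ∀ i, (subgroup i).Normal
  finiteIndex : ∀ i, (subgroup i).FiniteIndex
  iInf_eq_bot : ⨅ i, subgroup i = ⊥

/-- A group is residually finite if it admits a residual chain. -/
def IsResiduallyFinite (Γ : Type u) [Group Γ] : Prop :=
  Nonempty (ResidualChain Γ)

open Classical in
/-- The boundary `∂_S F = {γ ∈ F | γ * s ∉ F for some s ∈ S}`. -/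
def boundary {Γ : Type u} [Group Γ] (S F : Finset Γ) : Finset Γ :=
  F.filter fun γ => ∃ s ∈ S, γ * s ∉ F

/-- Amenability of a discrete group (not necessarily finitely generated), as the Følner condition:
for every finite `S ⊆ Γ` and `ε > 0` there is a non-empty finite `F ⊆ Γ` with `#∂_S F ≤ ε #F`. -/
def IsAmenable (Γ : Type u) [Group Γ] : Prop :=
  ∀ (S : Finset Γ) (ε : ℝ), 0 < ε →
    ∃ F : Finset Γ, F.Nonempty ∧ ((boundary S F).card : ℝ) ≤ ε * (F.card : ℝ)

/-! ### Resolutions of the trivial module and type `FP_n` -/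

/-- The integral group ring `ℤΓ`. -/
abbrev GroupRing (Γ : Type u) [Group Γ] : Type u := MonoidAlgebra ℤ Γ

/-- The trivial `ℤΓ`-module `ℤ`. -/
abbrev TrivialModule (Γ : Type u) [Group Γ] : Type :=
  (Representation.trivial ℤ Γ ℤ).asModule

/-- The chain complex `X` of `ℤΓ`-modules (in degrees `≥ 0`) is a resolution of the trivial
`ℤΓ`-module `ℤ`: for some augmentation `ε`, the sequence `⋯ → X₁ → X₀ → ℤ → 0` is exact. -/
def IsResolution {Γ : Type u} [Group Γ] (X : ChainComplex (ModuleCat.{u} (GroupRing Γ)) ℕ) :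
    Prop :=
  (∀ j : ℕ, Function.Exact (X.d (j + 2) (j + 1)).hom (X.d (j + 1) j).hom) ∧
    ∃ ε : X.X 0 →ₗ[GroupRing Γ] TrivialModule Γ,
      Function.Exact (X.d 1 0).hom ε ∧ Function.Surjective ε

/-- `Γ` is of type `FP_n`: the trivial `ℤΓ`-module `ℤ` has a projective resolution which is
finitely generated in all degrees `≤ n`. -/
def IsTypeFP (n : ℕ) (Γ : Type u) [Group Γ] : Prop :=
  ∃ P : ChainComplex (ModuleCat.{u} (GroupRing Γ)) ℕ,
    IsResolution P ∧ (∀ j, Module.Projective (GroupRing Γ) (P.X j)) ∧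
      ∀ j ≤ n, Module.Finite (GroupRing Γ) (P.X j)

/-! ### Based free chain complexes and weak rebuildings -/

/-- A based free chain complex (in degrees `≥ 0`): every chain module is endowed with a basis. -/
structure BasedComplex (R : Type u) [Ring R] where
  /-- the underlying chain complex -/
  complex : ChainComplex (ModuleCat.{v} R) ℕ
  /-- the index type of the basis in each degree -/
  index : ℕ → Type v
  /-- the basis in each degree -/
  basis : ∀ j, Module.Basis (index j) R (complex.X j)

/-- The `ℓ¹`-norm on a free `ℤ`-module with respect to a basis. -/
def l1Norm {ι : Type*} {M : Type*} [AddCommGroup M] [Module ℤ M] (b : Module.Basis ι ℤ M) (m : M) : ℝ≥0 :=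
  (b.repr m).sum fun _ z => (z.natAbs : ℝ≥0)

/-- The operator norm (possibly `∞`) of a homomorphism of based free `ℤ`-modules with respect to
the `ℓ¹`-norms. -/
def l1OpNorm {ι : Type*} {κ : Type*} {M : Type*} {L : Type*} [AddCommGroup M] [Module ℤ M]
    [AddCommGroup L] [Module ℤ L] (b : Module.Basis ι ℤ M) (c : Module.Basis κ ℤ L) (f : M →ₗ[ℤ] L) : ℝ≥0∞ :=
  ⨅ (C : ℝ≥0) (_ : ∀ m, l1Norm c (f m) ≤ C * l1Norm b m), (C : ℝ≥0∞)

/-- A homotopy retract: chain maps `ξ : X → X'`, `ξ' : X' → X` and a chain homotopy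
`Ξ : id_X ≃ ξ' ∘ ξ`. -/
structure HomotopyRetract {R : Type u} [Ring R] (X X' : ChainComplex (ModuleCat.{v} R) ℕ) where
  /-- the chain map from `X` to `X'` -/
  toFun : X ⟶ X'
  /-- the chain map from `X'` back to `X` -/
  invFun : X' ⟶ X
  /-- the chain homotopy -/
  homotopy : Homotopy (𝟙 X) (toFun ≫ invFun)

/-- The homotopy retract `h` is a weak `n`-rebuilding of `X` of quality `(T, κ)`: all chain modules
in degrees `≤ n` are finitely generated, and for all `j ≤ n`
`rk X'_j ≤ κ T⁻¹ rk X_j` and `‖∂^{X'}_j‖, ‖ξ_j‖ ≤ exp(κ) T ^ κ`.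
(In the `ℤ`-graded setting the rank estimate forces `X'_j = 0` for `j < 0`, since `X_j = 0` there;
so complexes are indexed by `ℕ`, and the differential in degree `0` vanishes.) -/
structure IsWeakRebuilding (n : ℕ) (T κ : ℝ) {X X' : BasedComplex.{0, v} ℤ}
    (h : HomotopyRetract X.complex X'.complex) : Prop where
  finite_source : ∀ j ≤ n, Module.Finite ℤ (X.complex.X j)
  finite_target : ∀ j ≤ n, Module.Finite ℤ (X'.complex.X j)
  rank_le : ∀ j ≤ n,
    (Module.finrank ℤ (X'.complex.X j) : ℝ) ≤ κ * T⁻¹ * (Module.finrank ℤ (X.complex.X j) : ℝ)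
  norm_d_le : ∀ j, j + 1 ≤ n →
    l1OpNorm (X'.basis (j + 1)) (X'.basis j) (X'.complex.d (j + 1) j).hom
      ≤ ENNReal.ofReal (Real.exp κ * T ^ κ)
  norm_map_le : ∀ j ≤ n,
    l1OpNorm (X.basis j) (X'.basis j) (h.toFun.f j).hom ≤ ENNReal.ofReal (Real.exp κ * T ^ κ)

/-! ### Coinvariants -/

section Coinvariants

variable {Γ : Type u} [Group Γ] (Λ : Subgroup Γ)

/-- The subgroup of a `ℤΓ`-module `M` generated by all `g • m - m` with `g ∈ Λ`, `m ∈ M`. -/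
def coinvariantsKer (M : Type v) [AddCommGroup M] [Module (GroupRing Γ) M] : Submodule ℤ M :=
  Submodule.span ℤ {x | ∃ g ∈ Λ, ∃ m : M, x = MonoidAlgebra.single g (1 : ℤ) • m - m}

/-- The `Λ`-coinvariants `M_Λ = ℤ ⊗_{ℤΛ} res M` of a `ℤΓ`-module `M`, that is, the largest quotient
of `M` on which `Λ` acts trivially. -/
abbrev Coinvariants (M : Type v) [AddCommGroup M] [Module (GroupRing Γ) M] : Type v :=
  M ⧸ coinvariantsKer Λ M

variable {M : Type v} [AddCommGroup M] [Module (GroupRing Γ) M]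
  {L : Type w} [AddCommGroup L] [Module (GroupRing Γ) L]

theorem coinvariantsKer_le_comap (f : M →ₗ[GroupRing Γ] L) :
    coinvariantsKer Λ M ≤ (coinvariantsKer Λ L).comap f.toAddMonoidHom.toIntLinearMap := by
  refine Submodule.span_le.2 ?_
  rintro x ⟨g, hg, m, rfl⟩
  refine Submodule.subset_span ⟨g, hg, f m, ?_⟩
  simp

/-- The homomorphism `f_Λ : M_Λ → L_Λ` induced by a `ℤΓ`-linear map `f : M → L`. -/
def coinvariantsMap (f : M →ₗ[GroupRing Γ] L) : Coinvariants Λ M →ₗ[ℤ] Coinvariants Λ L :=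
  Submodule.mapQ _ _ f.toAddMonoidHom.toIntLinearMap (coinvariantsKer_le_comap Λ f)

/-- The functor `(-)_Λ` from `ℤΓ`-modules to `ℤ`-modules. -/
def coinvariantsFunctor : ModuleCat.{v} (GroupRing Γ) ⥤ ModuleCat.{v} ℤ where
  obj M := ModuleCat.of ℤ (Coinvariants Λ M)
  map f := ModuleCat.ofHom (coinvariantsMap Λ f.hom)
  map_id M := by
    ext x
    rfl
  map_comp f g := by
    ext x
    rfl

instance : (coinvariantsFunctor.{u, v} Λ).Additive where
  map_add {M L f g} := by
    ext x
    obtain ⟨m, rfl⟩ := Submodule.mkQ_surjective _ x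
    rfl

variable {ι : Type w}

/-- For a family `b` in a `ℤΓ`-module `M`, the family of the classes of the `γ • b i` in `M_Λ`,
indexed by `i` and the right coset `Λγ`. -/
def coinvariantsFamily (b : ι → M) (p : ι × Quotient (QuotientGroup.rightRel Λ)) :
    Coinvariants Λ M :=
  Quotient.liftOn p.2
    (fun γ : Γ => (coinvariantsKer Λ M).mkQ (MonoidAlgebra.single γ (1 : ℤ) • b p.1))
    (by
      intro γ δ h
      have h' : δ * γ⁻¹ ∈ Λ := QuotientGroup.rightRel_apply.1 h
      have key : MonoidAlgebra.single δ (1 : ℤ) • b p.1 - MonoidAlgebra.single γ (1 : ℤ) • b p.1 ∈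
          coinvariantsKer Λ M := by
        refine Submodule.subset_span ⟨δ * γ⁻¹, h', MonoidAlgebra.single γ (1 : ℤ) • b p.1, ?_⟩
        rw [smul_smul, MonoidAlgebra.single_mul_single]
        simp
      exact ((Submodule.Quotient.eq _).2 key).symm)

@[simp]
theorem coinvariantsFamily_mk (b : ι → M) (i : ι) (γ : Γ) :
    coinvariantsFamily Λ b (i, Quotient.mk _ γ) =
      (coinvariantsKer Λ M).mkQ (MonoidAlgebra.single γ (1 : ℤ) • b i) := rfl

/-- The coordinates on `M` that descend to `M_Λ`. -/
def coinvariantsCoord (b : Module.Basis ι (GroupRing Γ) M) :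
    M →+ (ι × Quotient (QuotientGroup.rightRel Λ) →₀ ℤ) :=
  (Finsupp.liftAddHom fun i =>
    (Finsupp.mapDomain.addMonoidHom
      fun γ : Γ => (i, (Quotient.mk _ γ : Quotient (QuotientGroup.rightRel Λ)))).comp
        (MonoidAlgebra.coeffAddEquiv (R := ℤ) (M := Γ)).toAddMonoidHom).comp
    b.repr.toLinearMap.toAddMonoidHom

theorem coinvariantsCoord_single (b : Module.Basis ι (GroupRing Γ) M) (i : ι) (γ : Γ) (z : ℤ) :
    coinvariantsCoord Λ b (MonoidAlgebra.single γ z • b i) =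
      Finsupp.single (i, Quotient.mk _ γ) z := by
  simp [coinvariantsCoord, MonoidAlgebra.coeffAddEquiv, Finsupp.mapDomain_single]

/-- A free `ℤΓ`-module is additively generated by the translates of basis elements. -/
theorem basis_induction (b : Module.Basis ι (GroupRing Γ) M) {p : M → Prop} (zero : p 0)
    (add : ∀ x y, p x → p y → p (x + y))
    (single : ∀ i (γ : Γ) (z : ℤ), p (MonoidAlgebra.single γ z • b i)) (m : M) : p m := by
  rw [← b.linearCombination_repr m]
  induction b.repr m using Finsupp.induction_linear with
  | zero => simpa using zero
  | add f g hf hg => simpa using add _ _ hf hg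
  | single i r =>
    rw [Finsupp.linearCombination_single]
    induction r using MonoidAlgebra.induction_linear with
    | zero => simpa using zero
    | add f g hf hg => simpa [add_smul] using add _ _ hf hg
    | single γ z => exact single i γ z

theorem coinvariantsCoord_smul (b : Module.Basis ι (GroupRing Γ) M) {g : Γ} (hg : g ∈ Λ) (m : M) :
    coinvariantsCoord Λ b (MonoidAlgebra.single g (1 : ℤ) • m) = coinvariantsCoord Λ b m := by
  induction m using basis_induction b with
  | zero => simp
  | add x y hx hy => simp [hx, hy]
  | single i γ z =>
    rw [smul_smul, MonoidAlgebra.single_mul_single, coinvariantsCoord_single,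
      coinvariantsCoord_single, one_mul]
    congr 2
    refine Quotient.sound (QuotientGroup.rightRel_apply.2 ?_)
    simpa using hg

theorem linearIndependent_coinvariantsFamily (b : Module.Basis ι (GroupRing Γ) M) :
    LinearIndependent ℤ (coinvariantsFamily Λ b) := by
  have hker : coinvariantsKer Λ M ≤ LinearMap.ker (coinvariantsCoord Λ b).toIntLinearMap := by
    refine Submodule.span_le.2 ?_
    rintro x ⟨g, hg, m, rfl⟩
    simp [coinvariantsCoord_smul Λ b hg]
  refine LinearIndependent.of_comp ((coinvariantsKer Λ M).liftQ _ hker) ?_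
  have h : ((coinvariantsKer Λ M).liftQ _ hker ∘ coinvariantsFamily Λ b) =
      fun p => Finsupp.single p (1 : ℤ) := by
    funext p
    obtain ⟨i, q⟩ := p
    induction q using Quotient.inductionOn with
    | h γ =>
      rw [Function.comp_apply, coinvariantsFamily_mk, Submodule.mkQ_apply, Submodule.liftQ_apply]
      exact coinvariantsCoord_single Λ b i γ 1
  rw [h]
  exact Finsupp.linearIndependent_single_one ℤ _

theorem span_coinvariantsFamily (b : Module.Basis ι (GroupRing Γ) M) :
    ⊤ ≤ Submodule.span ℤ (Set.range (coinvariantsFamily Λ b)) := by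
  intro x _
  obtain ⟨m, rfl⟩ := Submodule.mkQ_surjective _ x
  induction m using basis_induction b with
  | zero => simp
  | add x y hx hy =>
    rw [map_add]
    exact Submodule.add_mem _ (hx trivial) (hy trivial)
  | single i γ z =>
    have h : (coinvariantsKer Λ M).mkQ (MonoidAlgebra.single γ z • b i) =
        z • coinvariantsFamily Λ b (i, Quotient.mk _ γ) := by
      rw [coinvariantsFamily_mk, ← map_zsmul, ← smul_assoc, MonoidAlgebra.smul_single]
      simp
    rw [h]
    exact Submodule.smul_mem _ _ (Submodule.subset_span ⟨_, rfl⟩)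

/-- The `ℤ`-basis of `M_Λ` induced by a `ℤΓ`-basis `b` of `M`: the classes of the `γ • b i`, one for
each `i` and each right coset `Λγ`. -/
def coinvariantsBasis (b : Module.Basis ι (GroupRing Γ) M) :
    Module.Basis (ι × Quotient (QuotientGroup.rightRel Λ)) ℤ (Coinvariants Λ M) :=
  Module.Basis.mk (linearIndependent_coinvariantsFamily Λ b) (span_coinvariantsFamily Λ b)

/-- The based free `ℤ`-chain complex `X_Λ` of `Λ`-coinvariants of a based free `ℤΓ`-chain
complex `X`. -/
def BasedComplex.coinvariants (X : BasedComplex.{u, u} (GroupRing Γ)) :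
    BasedComplex.{0, u} ℤ where
  complex := ((coinvariantsFunctor.{u, u} Λ).mapHomologicalComplex _).obj X.complex
  index j := X.index j × Quotient (QuotientGroup.rightRel Λ)
  basis j := coinvariantsBasis Λ (X.basis j)

end Coinvariants

/-! ### The algebraic cheap weak rebuilding property -/

/-- The based free `ℤΓ`-chain complex `X` is finitely generated in degrees `≤ n` and there is a
`κ ≥ 1` such that for all `T ≥ 1` and all residual chains `Λ_*` in `Γ`, the complex `X_{Λ_i}` admits
a weak `n`-rebuilding of quality `(T, κ)` for all large `i`. -/
def BasedComplex.IsCheapWeakRebuildable {Γ : Type u} [Group Γ] (n : ℕ)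
    (X : BasedComplex.{u, u} (GroupRing Γ)) : Prop :=
  (∀ j ≤ n, Module.Finite (GroupRing Γ) (X.complex.X j)) ∧
    ∃ κ : ℝ, 1 ≤ κ ∧ ∀ T : ℝ, 1 ≤ T → ∀ Λ : ResidualChain Γ, ∃ i₀ : ℕ, ∀ i ≥ i₀,
      ∃ (X' : BasedComplex.{0, u} ℤ)
        (h : HomotopyRetract (X.coinvariants (Λ.subgroup i)).complex X'.complex),
        IsWeakRebuilding n T κ h

/-- The class `CWR_n` of groups satisfying the algebraic cheap weak `n`-rebuilding property:
residually finite groups `Γ` such that the trivial `ℤΓ`-module `ℤ` has a based free resolution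
which is cheaply weakly `n`-rebuildable. -/
def CWR (n : ℕ) (Γ : Type u) [Group Γ] : Prop :=
  IsResiduallyFinite Γ ∧
    ∃ X : BasedComplex.{u, u} (GroupRing Γ), IsResolution X.complex ∧ X.IsCheapWeakRebuildable n

end CheapRebuilding

end

/-! For Λ deep in a residual chain, most of X_Λ is a faithful copy of pieces of the resolution X,
and X is additively contractible; so most of X_Λ can be collapsed to a point.

Amenability supplies a section ℓ : Λ\Γ → Γ with ℓ(xw) = ℓ(x)w for all w in a prescribed finite set
W, except at a small proportion of the x. It comes from a random tiling of G = Γ/Λ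
(`exists_section`): label G at random, let each x join, among the tiles tπ(F) containing it, the one
whose centre t has the smallest label, and lift every tile rigidly to Γ. Equivariance can fail at x
and w only if the smallest label over K = F ∪ Fw⁻¹ is attained outside F ∩ Fw⁻¹. All elements of K
being equally likely, this has small probability for a Følner set F, and averaging yields a good
labelling.

Basis elements of X_Λ over good points lift to X along ℓ. If W contains the products of at most n
elements of a set S supporting the differentials, the lift commutes with the differentials. An
additive contraction of X therefore descends to the span of the good elements, and subtracting the
resulting null-homotopic map from the identity gives φ ≃ id, which on this span is zero in positive
degrees and augmentation times a fixed point in degree 0 (`exists_collapse`). Hence φ factors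
through a complex X' generated by the bad basis elements and one extra element per degree
(`Collapse`).

The rank of X' is small because bad points are rare and, Γ being infinite, the index outgrows the
extra generator. The norms of ξ and of the differential of X' involve only the augmentation and the
differential of X, hence are bounded independently of T and Λ. The contraction has no controlled
norm, but it enters only ξ' and the homotopy, which a weak rebuilding leaves unconstrained. -/

namespace CheapRebuilding

/-! ### Sections of finite quotients with small defect -/

section MinHash

variable {G : Type*} [Fintype G] [DecidableEq G]

/-- Among the labellings of a finite type, each element of a given subset is equally often the one
with the smallest label. -/
theorem card_mul_card_argmin {m : ℕ} (U : Finset G) {c : G} (hc : c ∈ U) :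
    U.card * (Finset.univ.filter fun σ : G ≃ Fin m => ∀ u ∈ U, σ c ≤ σ u).card =
      Fintype.card (G ≃ Fin m) := by
  -- Precomposing labellings with the transposition of `a` and `c`, which preserves `U`, exchanges
  -- the two events.
  have hsymm : ∀ a ∈ U, (Finset.univ.filter fun σ : G ≃ Fin m => ∀ u ∈ U, σ a ≤ σ u).card =
      (Finset.univ.filter fun σ : G ≃ Fin m => ∀ u ∈ U, σ c ≤ σ u).card := by
    intro a ha
    have hswap : ∀ u ∈ U, Equiv.swap a c u ∈ U := by
      intro u hu
      rcases eq_or_ne u a with rfl | h1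
      · rwa [Equiv.swap_apply_left]
      rcases eq_or_ne u c with rfl | h2
      · rwa [Equiv.swap_apply_right]
      rwa [Equiv.swap_apply_of_ne_of_ne h1 h2]
    refine Finset.card_bij' (fun σ _ => (Equiv.swap a c).trans σ)
      (fun σ _ => (Equiv.swap a c).trans σ) ?_ ?_ ?_ ?_
    · intro σ hσ
      simp only [Finset.mem_filter, Finset.mem_univ, true_and, Equiv.trans_apply,
        Equiv.swap_apply_right] at hσ ⊢
      exact fun u hu => hσ _ (hswap u hu)
    · intro σ hσ
      simp only [Finset.mem_filter, Finset.mem_univ, true_and, Equiv.trans_apply,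
        Equiv.swap_apply_left] at hσ ⊢
      exact fun u hu => hσ _ (hswap u hu)
    · intro σ _
      ext x
      simp
    · intro σ _
      ext x
      simp
  have hunion : (Finset.univ : Finset (G ≃ Fin m)) =
      U.biUnion fun a => Finset.univ.filter fun σ : G ≃ Fin m => ∀ u ∈ U, σ a ≤ σ u := by
    ext σ
    obtain ⟨a, ha, hmin⟩ := U.exists_min_image (fun u => σ u) ⟨c, hc⟩
    simp only [Finset.mem_univ, Finset.mem_biUnion, Finset.mem_filter, true_and, true_iff]
    exact ⟨a, ha, hmin⟩
  rw [← smul_eq_mul, ← Finset.sum_const, ← Finset.sum_congr rfl hsymm, ← Finset.card_univ,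
    ← Finset.card_biUnion, ← hunion]
  intro a ha b hb hab
  refine Finset.disjoint_left.2 fun σ h1 h2 => hab ?_
  simp only [Finset.mem_filter, Finset.mem_univ, true_and] at h1 h2
  exact σ.injective (le_antisymm (h1 b hb) (h2 a ha))

end MinHash

/-! ### Random tilings by translates of a Følner set -/

section FoelnerSection

variable {Γ : Type*} [Group Γ] {G : Type*} [Group G] [Fintype G] [DecidableEq G]

open Classical in
/-- The elements of `F ∪ F w⁻¹` which do not lie in both `F` and `F w⁻¹`. -/
noncomputable def translateDiff (F : Finset Γ) (w : Γ) : Finset Γ :=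
  (F ∪ F.image (· * w⁻¹)).filter fun k => ¬ (k ∈ F ∧ k * w ∈ F)

-- The two halves F \ Fw⁻¹ and Fw⁻¹ \ F have the same size because F and Fw⁻¹ do, and the first lies
-- in the boundary.
open Classical in
theorem card_translateDiff_le {W : Finset Γ} (F : Finset Γ) {w : Γ} (hw : w ∈ W) :
    (translateDiff F w).card ≤ 2 * (boundary W F).card := by
  have hb : (F.filter fun k => k * w ∉ F) ⊆ boundary W F := by
    intro k hk
    rw [Finset.mem_filter] at hk
    exact Finset.mem_filter.2 ⟨hk.1, w, hw, hk.2⟩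
  have h1 : translateDiff F w ⊆
      (F.filter fun k => k * w ∉ F) ∪ (F.image (· * w⁻¹) \ F) := by
    intro k hk
    simp only [translateDiff, Finset.mem_filter, Finset.mem_union, Finset.mem_image,
      Finset.mem_sdiff] at hk ⊢
    rcases hk with ⟨hk | hk, hn⟩
    · exact Or.inl ⟨hk, fun h => hn ⟨hk, h⟩⟩
    · refine Or.inr ⟨hk, fun h => hn ⟨h, ?_⟩⟩
      obtain ⟨f, hf, rfl⟩ := hk
      simpa using hf
  have hinj : Function.Injective (· * w⁻¹ : Γ → Γ) := mul_left_injective _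
  have h2 : (F.image (· * w⁻¹) \ F).card = (F \ F.image (· * w⁻¹)).card :=
    Finset.card_sdiff_comm (Finset.card_image_of_injective _ hinj)
  have h3 : F \ F.image (· * w⁻¹) ⊆ F.filter fun k => k * w ∉ F := by
    intro k hk
    rw [Finset.mem_sdiff] at hk
    exact Finset.mem_filter.2 ⟨hk.1, fun h => hk.2 (Finset.mem_image.2 ⟨_, h, by simp⟩)⟩
  calc (translateDiff F w).card ≤ _ := Finset.card_le_card h1
    _ ≤ _ := Finset.card_union_le _ _
    _ ≤ (boundary W F).card + (boundary W F).card := by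
        rw [h2]
        exact add_le_add (Finset.card_le_card hb)
          ((Finset.card_le_card h3).trans (Finset.card_le_card hb))
    _ = _ := by ring

open Classical in
/-- A finite quotient `π : Γ → G` has a set-theoretic section which is right equivariant with
respect to each `w ∈ W` up to a proportion of points controlled by a set `F` that is mapped
injectively to `G`. -/
theorem exists_section (π : Γ →* G) (hπ : Function.Surjective π) {F : Finset Γ}
    (hF : F.Nonempty) (W : Finset Γ)
    (hinj : ∀ w ∈ W, Set.InjOn π (↑(F ∪ F.image (· * w⁻¹)) : Set Γ)) :
    ∃ ℓ : G → Γ, (∀ x, π (ℓ x) = x) ∧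
      F.card * (Finset.univ.filter fun x => ∃ w ∈ W, ℓ (x * π w) ≠ ℓ x * w).card ≤
        Fintype.card G * ∑ w ∈ W, (translateDiff F w).card := by
  let lift := Function.surjInv hπ
  have hlift : ∀ t, π (lift t) = t := Function.surjInv_eq hπ
  let L := G ≃ Fin (Fintype.card G)
  -- The elements x π(f)⁻¹ are the centres of the tiles containing x; the one with the smallest
  -- label wins.
  have hmin : ∀ (σ : L) (x : G), ∃ f ∈ F, ∀ f' ∈ F, σ (x * (π f)⁻¹) ≤ σ (x * (π f')⁻¹) :=
    fun σ x => F.exists_min_image (fun f => σ (x * (π f)⁻¹)) hF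
  choose f hfF hfmin using hmin
  let ℓ : L → G → Γ := fun σ x => lift (x * (π (f σ x))⁻¹) * f σ x
  let K : Γ → Finset Γ := fun w => F ∪ F.image (· * w⁻¹)
  have hmemK : ∀ w k, k ∈ K w ↔ k ∈ F ∨ k * w ∈ F := by
    intro w k
    simp only [K, Finset.mem_union, Finset.mem_image]
    refine or_congr Iff.rfl ⟨?_, fun h => ⟨_, h, by simp⟩⟩
    rintro ⟨f, hf, rfl⟩
    simpa using hf
  -- if the minimiser over `K w` is shared then the section is equivariant
  have key : ∀ (σ : L) (x : G), ∀ w ∈ W, ℓ σ (x * π w) ≠ ℓ σ x * w →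
      ∃ k ∈ translateDiff F w, ∀ k' ∈ K w, σ (x * (π k)⁻¹) ≤ σ (x * (π k')⁻¹) := by
    intro σ x w hw hne
    obtain ⟨k, hk, hkmin⟩ := (K w).exists_min_image (fun k => σ (x * (π k)⁻¹))
      (hF.mono Finset.subset_union_left)
    refine ⟨k, Finset.mem_filter.2 ⟨hk, ?_⟩, hkmin⟩
    rintro ⟨hk1, hk2⟩
    apply hne
    -- Since (xπ(w)) π(kw)⁻¹ = x π(k)⁻¹, the minimiser `k` for x corresponds to `k * w` for xπ(w):
    -- both points choose the same tile, which is lifted as a whole.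
    have e1 : f σ x = k := by
      refine hinj w hw ((hmemK _ _).2 (Or.inl (hfF σ x))) hk ?_
      have := le_antisymm (hfmin σ x k hk1) (hkmin _ ((hmemK _ _).2 (Or.inl (hfF σ x))))
      simpa using σ.injective this
    have e2 : f σ (x * π w) * w⁻¹ = k := by
      have hm : f σ (x * π w) * w⁻¹ ∈ K w :=
        (hmemK _ _).2 (Or.inr (by simpa using hfF σ (x * π w)))
      refine hinj w hw hm hk ?_
      have h1 := hfmin σ (x * π w) (k * w) hk2
      have h2 := hkmin _ hm
      simp only [map_mul, map_inv, mul_inv_rev, inv_inv, mul_assoc, mul_inv_cancel_left] at h1 h2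
      have := σ.injective (le_antisymm h1 h2)
      have h3 : π w * (π (f σ (x * π w)))⁻¹ = (π k)⁻¹ := mul_left_cancel this
      rw [map_mul, map_inv, ← inv_inj, ← h3]
      simp
    have e3 : f σ (x * π w) = k * w := by rw [← e2]; simp
    simp only [ℓ, e1, e3, map_mul, mul_inv_rev, mul_assoc, mul_inv_cancel_left]
  -- For fixed x and w, the failure probability is at most #`translateDiff F w` / #`K w`, and #F ≤
  -- #`K w`.
  have hcount : ∀ (x : G), ∀ w ∈ W,
      F.card * (Finset.univ.filter fun σ : L => ℓ σ (x * π w) ≠ ℓ σ x * w).card ≤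
        (translateDiff F w).card * Fintype.card L := by
    intro x w hw
    have hU : ∀ k ∈ K w,
        (K w).card * (Finset.univ.filter fun σ : L =>
          ∀ k' ∈ K w, σ (x * (π k)⁻¹) ≤ σ (x * (π k')⁻¹)).card = Fintype.card L := by
      intro k hk
      have hi : Set.InjOn (fun k => x * (π k)⁻¹) (K w : Set Γ) := by
        intro a ha b hb hab
        exact hinj w hw ha hb (by simpa using hab)
      have := card_mul_card_argmin (m := Fintype.card G) ((K w).image fun k => x * (π k)⁻¹)
        (Finset.mem_image_of_mem (fun k => x * (π k)⁻¹) hk)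
      rw [Finset.card_image_of_injOn hi] at this
      simpa only [Finset.forall_mem_image] using this
    have hsub : (Finset.univ.filter fun σ : L => ℓ σ (x * π w) ≠ ℓ σ x * w) ⊆
        (translateDiff F w).biUnion fun k => Finset.univ.filter fun σ : L =>
          ∀ k' ∈ K w, σ (x * (π k)⁻¹) ≤ σ (x * (π k')⁻¹) := by
      intro σ hσ
      obtain ⟨k, hk, h⟩ := key σ x w hw (Finset.mem_filter.1 hσ).2
      exact Finset.mem_biUnion.2 ⟨k, hk, Finset.mem_filter.2 ⟨Finset.mem_univ _, h⟩⟩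
    calc F.card * (Finset.univ.filter fun σ : L => ℓ σ (x * π w) ≠ ℓ σ x * w).card
        ≤ (K w).card * ∑ k ∈ translateDiff F w, (Finset.univ.filter fun σ : L =>
          ∀ k' ∈ K w, σ (x * (π k)⁻¹) ≤ σ (x * (π k')⁻¹)).card :=
          Nat.mul_le_mul (Finset.card_le_card Finset.subset_union_left)
            ((Finset.card_le_card hsub).trans Finset.card_biUnion_le)
      _ = ∑ k ∈ translateDiff F w, Fintype.card L := by
          rw [Finset.mul_sum]
          exact Finset.sum_congr rfl fun k hk => hU k (Finset.mem_filter.1 hk).1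
      _ = _ := by rw [Finset.sum_const, smul_eq_mul]
  -- Double counting over labellings and points; some labelling is then no worse than average.
  have htotal : ∑ σ : L, F.card *
      (Finset.univ.filter fun x => ∃ w ∈ W, ℓ σ (x * π w) ≠ ℓ σ x * w).card ≤
        ∑ _σ : L, Fintype.card G * ∑ w ∈ W, (translateDiff F w).card := by
    calc ∑ σ : L, F.card *
          (Finset.univ.filter fun x => ∃ w ∈ W, ℓ σ (x * π w) ≠ ℓ σ x * w).card
        ≤ ∑ σ : L, F.card * ∑ w ∈ W,
          (Finset.univ.filter fun x => ℓ σ (x * π w) ≠ ℓ σ x * w).card := by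
          refine Finset.sum_le_sum fun σ _ => Nat.mul_le_mul le_rfl
            ((Finset.card_le_card ?_).trans Finset.card_biUnion_le)
          intro x hx
          obtain ⟨w, hw, h⟩ := (Finset.mem_filter.1 hx).2
          exact Finset.mem_biUnion.2 ⟨w, hw, Finset.mem_filter.2 ⟨Finset.mem_univ _, h⟩⟩
      _ = ∑ w ∈ W, ∑ x : G, F.card *
          (Finset.univ.filter fun σ : L => ℓ σ (x * π w) ≠ ℓ σ x * w).card := by
          simp only [Finset.mul_sum, Finset.card_filter]
          rw [Finset.sum_comm]
          exact Finset.sum_congr rfl fun w _ => Finset.sum_comm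
      _ ≤ ∑ w ∈ W, ∑ _x : G, (translateDiff F w).card * Fintype.card L :=
          Finset.sum_le_sum fun w hw => Finset.sum_le_sum fun x _ => hcount x w hw
      _ = _ := by
          simp only [Finset.sum_const, smul_eq_mul, Finset.card_univ, Finset.mul_sum]
          exact Finset.sum_congr rfl fun w _ => by ring
  have hne : (Finset.univ : Finset L).Nonempty := ⟨Fintype.equivFin G, Finset.mem_univ _⟩
  obtain ⟨σ, -, hσ⟩ := Finset.exists_le_of_sum_le hne htotal
  exact ⟨ℓ σ, fun x => by simp [ℓ, hlift], hσ⟩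

end FoelnerSection

/-! ### Finite quotients far out in a residual chain -/

namespace ResidualChain

variable {Γ : Type u} [Group Γ] (Λ : ResidualChain Γ)

/-- The quotient maps by the subgroups far out in a residual chain are injective on a given finite
set. -/
theorem eventually_injOn (K : Finset Γ) :
    ∃ i₀, ∀ i ≥ i₀, ∀ a ∈ K, ∀ b ∈ K, a * b⁻¹ ∈ Λ.subgroup i → a = b := by
  have h : ∀ p : Γ × Γ, ∃ i₀, ∀ i ≥ i₀, p.1 * p.2⁻¹ ∈ Λ.subgroup i → p.1 = p.2 := by
    intro p
    by_cases hp : p.1 = p.2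
    · exact ⟨0, fun _ _ _ => hp⟩
    have : p.1 * p.2⁻¹ ∉ ⨅ i, Λ.subgroup i := by
      rw [Λ.iInf_eq_bot, Subgroup.mem_bot, mul_inv_eq_one]
      exact hp
    rw [Subgroup.mem_iInf, not_forall] at this
    obtain ⟨i₀, hi₀⟩ := this
    exact ⟨i₀, fun i hi hmem => absurd (Λ.antitone hi hmem) hi₀⟩
  choose N hN using h
  refine ⟨(K ×ˢ K).sup N, fun i hi a ha b hb hab => hN (a, b) i ?_ hab⟩
  exact (Finset.le_sup (f := N) (Finset.mk_mem_product ha hb)).trans hi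

instance (i : ℕ) : Finite (Quotient (QuotientGroup.rightRel (Λ.subgroup i))) :=
  have := Λ.finiteIndex i
  Finite.of_equiv _ (QuotientGroup.quotientRightRelEquivQuotientLeftRel (Λ.subgroup i)).symm

/-- The indices in a residual chain of an infinite group are unbounded. -/
theorem eventually_le_card [Infinite Γ] (m : ℕ) :
    ∃ i₀, ∀ i ≥ i₀, m ≤ Nat.card (Quotient (QuotientGroup.rightRel (Λ.subgroup i))) := by
  obtain ⟨K, rfl⟩ := Infinite.exists_subset_card_eq Γ m
  obtain ⟨i₀, h⟩ := Λ.eventually_injOn K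
  refine ⟨i₀, fun i hi => ?_⟩
  have hinj : Function.Injective
      (fun a : K => (Quotient.mk _ (a : Γ) :
        Quotient (QuotientGroup.rightRel (Λ.subgroup i)))) := by
    intro a b hab
    exact Subtype.ext (h i hi b b.2 a a.2
      (QuotientGroup.rightRel_apply.1 (Quotient.exact hab))).symm
  simpa using Nat.card_le_card_of_injective _ hinj

/-- In an amenable group, the finite quotients far out in a residual chain have sections which are
right equivariant for a given finite set, up to a small proportion of points. -/
theorem eventually_exists_section (hΓ : IsAmenable Γ) (W : Finset Γ) {ε : ℝ} (hε : 0 < ε) :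
    ∃ i₀, ∀ i ≥ i₀, ∃ ℓ : Quotient (QuotientGroup.rightRel (Λ.subgroup i)) → Γ,
      (∀ x, Quotient.mk _ (ℓ x) = x) ∧
      (Nat.card {x // ∃ w ∈ W, ℓ (Quotient.mk _ (ℓ x * w)) ≠ ℓ x * w} : ℝ) ≤
        ε * Nat.card (Quotient (QuotientGroup.rightRel (Λ.subgroup i))) := by
  classical
  -- The 2 comes from `card_translateDiff_le`, the factor #W from summing over w; the +1 avoids
  -- division by zero for empty W.
  obtain ⟨F, hF, hFW⟩ := hΓ W (ε / (2 * (W.card + 1))) (by positivity)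
  obtain ⟨i₀, h⟩ := Λ.eventually_injOn (F ∪ W.biUnion fun w => F.image (· * w⁻¹))
  refine ⟨i₀, fun i hi => ?_⟩
  have := Λ.normal i
  have := Λ.finiteIndex i
  let N := Λ.subgroup i
  let Q := Quotient (QuotientGroup.rightRel N)
  have : Fintype (Γ ⧸ N) := Fintype.ofFinite _
  let π : Γ →* Γ ⧸ N := QuotientGroup.mk' N
  have hπ : ∀ a b : Γ, π a = π b ↔ a * b⁻¹ ∈ N := by
    intro a b
    rw [QuotientGroup.mk'_apply, QuotientGroup.mk'_apply, eq_comm, QuotientGroup.eq,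
      (Λ.normal i).mem_comm_iff]
  obtain ⟨ℓ, hℓ, hcard⟩ := exists_section π (QuotientGroup.mk'_surjective N) hF W (by
    intro w hw a ha b hb hab
    have hsub : F ∪ F.image (· * w⁻¹) ⊆ F ∪ W.biUnion fun w => F.image (· * w⁻¹) :=
      Finset.union_subset_union_right
        (Finset.subset_biUnion_of_mem (fun w => F.image (· * w⁻¹)) hw)
    exact h i hi a (hsub ha) b (hsub hb) ((hπ a b).1 hab))
  -- By normality, right cosets, which index the bases of coinvariants, agree with left cosets,
  -- which form the quotient group.
  let τ : Q ≃ Γ ⧸ N := Quotient.congr (Equiv.refl Γ) (by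
    intro a b
    change QuotientGroup.rightRel N a b ↔ QuotientGroup.leftRel N a b
    rw [QuotientGroup.rightRel_apply, QuotientGroup.leftRel_apply, (Λ.normal i).mem_comm_iff])
  have hτ : ∀ γ : Γ, τ (Quotient.mk _ γ) = π γ := fun _ => rfl
  refine ⟨fun x => ℓ (τ x), fun x => τ.injective (by rw [hτ, hℓ]), ?_⟩
  have hbad : Nat.card {x : Q // ∃ w ∈ W, ℓ (τ (Quotient.mk _ (ℓ (τ x) * w))) ≠ ℓ (τ x) * w} =
      (Finset.univ.filter fun x => ∃ w ∈ W, ℓ (x * π w) ≠ ℓ x * w).card := by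
    rw [← Fintype.card_subtype, ← Nat.card_eq_fintype_card]
    refine Nat.card_congr (τ.subtypeEquiv fun x => ?_)
    simp only [hτ, map_mul, hℓ]
  rw [show Nat.card (Quotient (QuotientGroup.rightRel (Λ.subgroup i))) = Fintype.card (Γ ⧸ N) by
    rw [← Nat.card_eq_fintype_card]; exact Nat.card_congr τ]
  erw [hbad]
  set c := (Finset.univ.filter fun x => ∃ w ∈ W, ℓ (x * π w) ≠ ℓ x * w).card
  have hFpos : (0 : ℝ) < F.card := by exact_mod_cast hF.card_pos
  have h1 : (F.card : ℝ) * c ≤ Fintype.card (Γ ⧸ N) * (W.card * (2 * (boundary W F).card)) := by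
    have : ∑ w ∈ W, (translateDiff F w).card ≤ W.card * (2 * (boundary W F).card) := by
      rw [← smul_eq_mul, ← Finset.sum_const]
      exact Finset.sum_le_sum fun w hw => card_translateDiff_le F hw
    exact_mod_cast hcard.trans (Nat.mul_le_mul le_rfl this)
  have h2 : (W.card : ℝ) * (2 * (boundary W F).card) ≤ ε * F.card := by
    calc (W.card : ℝ) * (2 * (boundary W F).card)
        ≤ (W.card + 1) * (2 * (ε / (2 * (W.card + 1)) * F.card)) := by gcongr; linarith
      _ = ε * F.card := by field_simp
  refine le_of_mul_le_mul_left (h1.trans ?_) hFpos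
  calc (Fintype.card (Γ ⧸ N) : ℝ) * (W.card * (2 * (boundary W F).card))
      ≤ Fintype.card (Γ ⧸ N) * (ε * F.card) := by gcongr
    _ = _ := by ring

end ResidualChain

end CheapRebuilding

noncomputable section
namespace CheapRebuilding

/-! ### Free resolutions of finite type -/

section FiniteResolutions

variable {R : Type u} [Ring R]

/-- The module `M` has a partial resolution of length `n` by finitely generated projective
modules. -/
def HasFiniteProjectiveResolution : ∀ (_ : ℕ) (M : Type u) [AddCommGroup M] [Module R M], Prop
  | 0, _, _, _ => True
  | n + 1, M, _, _ => ∃ (P : ModuleCat.{u} R) (f : P →ₗ[R] M), Module.Projective R P ∧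
      Module.Finite R P ∧ Function.Surjective f ∧
        HasFiniteProjectiveResolution n (LinearMap.ker f)

/-- The module `M` has a partial resolution of length `n` by non-trivial finitely generated free
modules. -/
def HasFiniteFreeResolution : ∀ (_ : ℕ) (M : Type u) [AddCommGroup M] [Module R M], Prop
  | 0, _, _, _ => True
  | n + 1, M, _, _ => ∃ (I : Type u) (f : (I →₀ R) →ₗ[R] M), Nonempty I ∧ Finite I ∧
      Function.Surjective f ∧ HasFiniteFreeResolution n (LinearMap.ker f)

theorem HasFiniteProjectiveResolution.of_equiv {n : ℕ} {M N : Type u} [AddCommGroup M]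
    [Module R M] [AddCommGroup N] [Module R N] (e : M ≃ₗ[R] N)
    (h : HasFiniteProjectiveResolution (R := R) n M) :
    HasFiniteProjectiveResolution (R := R) n N := by
  cases n with
  | zero => trivial
  | succ n =>
    obtain ⟨P, f, hP, hfin, hf, hker⟩ := h
    refine ⟨P, e.toLinearMap ∘ₗ f, hP, hfin, e.surjective.comp hf, ?_⟩
    rwa [LinearMap.ker_comp_of_ker_eq_bot _ e.ker]

theorem HasFiniteProjectiveResolution.prod {n : ℕ} {M : Type u} [AddCommGroup M] [Module R M]
    (h : HasFiniteProjectiveResolution (R := R) n M) (Q : Type u) [AddCommGroup Q] [Module R Q]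
    [Module.Projective R Q] [Module.Finite R Q] :
    HasFiniteProjectiveResolution (R := R) n (M × Q) := by
  cases n with
  | zero => trivial
  | succ n =>
    obtain ⟨P, f, hP, hfin, hf, hker⟩ := h
    refine ⟨ModuleCat.of R (P × Q), f.prodMap LinearMap.id, inferInstanceAs
      (Module.Projective R (P × Q)), inferInstanceAs (Module.Finite R (P × Q)),
      hf.prodMap Function.surjective_id, ?_⟩
    refine HasFiniteProjectiveResolution.of_equiv ?_ hker
    refine LinearEquiv.ofBijective
      ((LinearMap.inl R P Q ∘ₗ (LinearMap.ker f).subtype).codRestrict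
        (LinearMap.ker (f.prodMap LinearMap.id)) (fun x => by simp)) ⟨?_, ?_⟩
    · intro x y hxy
      exact Subtype.ext (congrArg Prod.fst (congrArg Subtype.val hxy))
    · rintro ⟨⟨p, q⟩, hpq⟩
      simp only [LinearMap.mem_ker, LinearMap.prodMap_apply, LinearMap.id_apply,
        Prod.mk_eq_zero] at hpq
      obtain ⟨hp, rfl⟩ := hpq
      exact ⟨⟨p, hp⟩, rfl⟩

/-- For a surjection `f` and a split surjection `r`, the kernel of `f ∘ r` is the sum of the kernels
of `f` and `r`. -/
def kerCompEquiv {M P F : Type*} [AddCommGroup M] [Module R M] [AddCommGroup P] [Module R P]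
    [AddCommGroup F] [Module R F] (f : P →ₗ[R] M) (r : F →ₗ[R] P) (s : P →ₗ[R] F)
    (hrs : r ∘ₗ s = LinearMap.id) :
    (LinearMap.ker f × LinearMap.ker r) ≃ₗ[R] LinearMap.ker (f ∘ₗ r) :=
  have hrs' : ∀ p, r (s p) = p := fun p => LinearMap.congr_fun hrs p
  LinearEquiv.ofBijective
    ((((s ∘ₗ (LinearMap.ker f).subtype).coprod (LinearMap.ker r).subtype)).codRestrict
      (LinearMap.ker (f ∘ₗ r)) (fun x => by simp [hrs'])) (by
    constructor
    · rintro ⟨⟨a, ha⟩, ⟨b, hb⟩⟩ ⟨⟨a', ha'⟩, ⟨b', hb'⟩⟩ hab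
      have h1 : s a + b = s a' + b' := congrArg Subtype.val hab
      rw [LinearMap.mem_ker] at hb hb'
      have h2 : a = a' := by simpa [hrs', hb, hb'] using congrArg r h1
      subst h2
      have h3 : b = b' := add_left_cancel h1
      subst h3
      rfl
    · rintro ⟨x, hx⟩
      refine ⟨⟨⟨r x, hx⟩, ⟨x - s (r x), by simp [hrs']⟩⟩, Subtype.ext ?_⟩
      exact add_sub_cancel (s (r x)) x)

/-- A finitely generated module is the quotient of a non-trivial finitely generated free
module. -/
theorem exists_finite_free_cover (P : Type u) [AddCommGroup P] [Module R P] [Module.Finite R P] :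
    ∃ (I : Type u) (f : (I →₀ R) →ₗ[R] P), Nonempty I ∧ Finite I ∧ Function.Surjective f := by
  classical
  obtain ⟨s, hs⟩ := Module.Finite.fg_top (R := R) (M := P)
  -- Inserting 0 makes the index type non-empty. Positive rank is needed later to absorb the extra
  -- generator of the collapsed complex.
  refine ⟨↥(insert 0 s), Finsupp.linearCombination R Subtype.val,
    ⟨⟨0, Finset.mem_insert_self _ _⟩⟩, inferInstance, ?_⟩
  rw [← LinearMap.range_eq_top, Finsupp.range_linearCombination, eq_top_iff, ← hs]
  refine Submodule.span_mono ?_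
  intro x hx
  exact ⟨⟨x, Finset.mem_insert_of_mem hx⟩, rfl⟩

/-- Replacing P by a free cover r : F → P enlarges the syzygy to ker f × ker r. Since r splits, ker
r is finitely generated projective, so it can be added to the next term of the resolution. -/
theorem HasFiniteProjectiveResolution.hasFiniteFreeResolution {n : ℕ} :
    ∀ {M : Type u} [AddCommGroup M] [Module R M],
      HasFiniteProjectiveResolution (R := R) n M → HasFiniteFreeResolution (R := R) n M := by
  induction n with
  | zero => exact fun _ => trivial
  | succ n ih =>
    intro M _ _ h
    obtain ⟨P, f, hP, hfin, hf, hker⟩ := h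
    obtain ⟨I, r, hne, hI, hr⟩ := exists_finite_free_cover (R := R) P
    obtain ⟨s, hs⟩ := Module.projective_lifting_property r LinearMap.id hr
    have hs' : ∀ p, r (s p) = p := fun p => LinearMap.congr_fun hs p
    have hretract : ((LinearMap.id - s ∘ₗ r).codRestrict (LinearMap.ker r)
        (fun x => by simp [hs'])).comp (LinearMap.ker r).subtype = LinearMap.id := by
      ext x
      simp
    have : Module.Projective R (LinearMap.ker r) := Module.Projective.of_split _ _ hretract
    have : Module.Finite R (LinearMap.ker r) :=
      Module.Finite.of_surjective _ (LinearMap.surjective_of_comp_eq_id _ _ hretract)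
    refine ⟨I, f ∘ₗ r, hne, hI, hf.comp hr, ih ?_⟩
    exact (hker.prod (LinearMap.ker r)).of_equiv (kerCompEquiv f r s hs)

/-- One step of a free resolution. -/
theorem HasFiniteFreeResolution.exists_cover {n : ℕ} {M : Type u} [AddCommGroup M] [Module R M]
    (h : HasFiniteFreeResolution (R := R) n M) :
    ∃ (I : Type u) (f : (I →₀ R) →ₗ[R] M), Nonempty I ∧ (0 < n → Finite I) ∧
      Function.Surjective f ∧ HasFiniteFreeResolution (R := R) (n - 1) (LinearMap.ker f) := by
  cases n with
  | zero =>
    refine ⟨M, Finsupp.linearCombination R id, ⟨0⟩, fun h => absurd h (lt_irrefl 0),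
      Finsupp.linearCombination_id_surjective R M, trivial⟩
  | succ n =>
    obtain ⟨I, f, hne, hI, hf, hker⟩ := h
    exact ⟨I, f, hne, fun _ => hI, hf, hker⟩

/-- The syzygy modules in the construction of a free resolution. -/
structure Syzygy (R : Type u) [Ring R] where
  /-- the module to be resolved -/
  module : ModuleCat.{u} R
  /-- the number of degrees in which the resolution is required to be finitely generated -/
  length : ℕ
  hasFiniteFreeResolution : HasFiniteFreeResolution (R := R) length module

namespace Syzygy

/-- The index type of the basis of a free module covering a given module. -/
def index (S : Syzygy R) : Type u := S.hasFiniteFreeResolution.exists_cover.choose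

/-- The surjection from a free module onto a given module. -/
def cover (S : Syzygy R) : (S.index →₀ R) →ₗ[R] S.module :=
  S.hasFiniteFreeResolution.exists_cover.choose_spec.choose

theorem cover_spec (S : Syzygy R) : Nonempty S.index ∧ (0 < S.length → Finite S.index) ∧
    Function.Surjective S.cover ∧
      HasFiniteFreeResolution (R := R) (S.length - 1) (LinearMap.ker S.cover) :=
  S.hasFiniteFreeResolution.exists_cover.choose_spec.choose_spec

/-- The next syzygy. -/
def next (S : Syzygy R) : Syzygy R where
  module := ModuleCat.of R (LinearMap.ker S.cover)
  length := S.length - 1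
  hasFiniteFreeResolution := S.cover_spec.2.2.2

/-- The iterated syzygies. -/
def iter (S : Syzygy R) : ℕ → Syzygy R
  | 0 => S
  | j + 1 => (S.iter j).next

theorem length_iter (S : Syzygy R) (j : ℕ) : (S.iter j).length = S.length - j := by
  induction j with
  | zero => rfl
  | succ j ih =>
    change (S.iter j).length - 1 = _
    omega

/-- The differential of the free resolution. -/
def differential (S : Syzygy R) (j : ℕ) :
    ((S.iter (j + 1)).index →₀ R) →ₗ[R] ((S.iter j).index →₀ R) :=
  (LinearMap.ker (S.iter j).cover).subtype ∘ₗ (S.iter (j + 1)).cover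

theorem range_differential (S : Syzygy R) (j : ℕ) :
    LinearMap.range (S.differential j) = LinearMap.ker (S.iter j).cover := by
  refine (LinearMap.range_comp_of_range_eq_top _ ?_).trans (Submodule.range_subtype _)
  exact LinearMap.range_eq_top.2 (S.iter (j + 1)).cover_spec.2.2.1

theorem ker_differential (S : Syzygy R) (j : ℕ) :
    LinearMap.ker (S.differential j) = LinearMap.ker (S.iter (j + 1)).cover :=
  LinearMap.ker_comp_of_ker_eq_bot _ (Submodule.ker_subtype _)

theorem exact_differential (S : Syzygy R) (j : ℕ) :
    Function.Exact (S.differential (j + 1)) (S.differential j) :=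
  LinearMap.exact_iff.2 ((S.ker_differential j).trans (S.range_differential (j + 1)).symm)

theorem exact_cover (S : Syzygy R) : Function.Exact (S.differential 0) S.cover :=
  LinearMap.exact_iff.2 (S.range_differential 0).symm

/-- The free resolution. -/
def resolution (S : Syzygy R) : BasedComplex.{u, u} R where
  complex := ChainComplex.of (fun j => ModuleCat.of R ((S.iter j).index →₀ R))
    (fun j => ModuleCat.ofHom (S.differential j)) (by
      intro j
      rw [← ModuleCat.ofHom_comp]
      refine congrArg ModuleCat.ofHom ?_
      refine LinearMap.range_le_ker_iff.1 (le_of_eq ?_)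
      rw [range_differential, ker_differential])
  index j := (S.iter j).index
  basis j := Finsupp.basisSingleOne

theorem resolution_d (S : Syzygy R) (j : ℕ) :
    (S.resolution.complex.d (j + 1) j).hom = S.differential j := by
  have h : S.resolution.complex.d (j + 1) j = ModuleCat.ofHom (S.differential j) :=
    ChainComplex.of_d (fun j => ModuleCat.of R ((S.iter j).index →₀ R))
      (fun j => ModuleCat.ofHom (S.differential j)) j
  rw [h]
  rfl

end Syzygy

end FiniteResolutions

/-! ### Free resolutions for groups of type FP_n -/

section TypeFP

variable {Γ : Type u} [Group Γ]

/-- The successive syzygies are the images of the differentials. The length is n + 1 because degrees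
0, …, n contribute that many modules; `ULift` moves ℤ into the universe of Γ. -/
theorem IsTypeFP.hasFiniteProjectiveResolution {n : ℕ} (h : IsTypeFP n Γ) :
    HasFiniteProjectiveResolution (R := GroupRing Γ) (n + 1) (ULift.{u} (TrivialModule Γ)) := by
  obtain ⟨P, ⟨hex, ε, hε, hsurj⟩, hproj, hfin⟩ := h
  have hrange : ∀ m j, j + m ≤ n → HasFiniteProjectiveResolution (R := GroupRing Γ) m
      (LinearMap.range (P.d (j + 1) j).hom) := by
    intro m
    induction m with
    | zero => exact fun _ _ => trivial
    | succ m ih =>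
      intro j hj
      refine ⟨P.X (j + 1), (P.d (j + 1) j).hom.rangeRestrict, hproj _, hfin _ (by omega),
        LinearMap.surjective_rangeRestrict _, ?_⟩
      rw [LinearMap.ker_rangeRestrict, (hex j).linearMap_ker_eq]
      exact ih (j + 1) (by omega)
  refine ⟨P.X 0, ULift.moduleEquiv.symm.toLinearMap ∘ₗ ε, hproj 0, hfin 0 (Nat.zero_le _),
    (ULift.moduleEquiv (R := GroupRing Γ)).symm.surjective.comp hsurj, ?_⟩
  rw [LinearMap.ker_comp_of_ker_eq_bot _ (LinearEquiv.ker _), hε.linearMap_ker_eq]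
  exact hrange n 0 (by omega)

/-- A group of type `FP_n` has a based free resolution which is finitely generated in degrees
`≤ n` and non-trivial in all degrees. -/
theorem IsTypeFP.exists_resolution {n : ℕ} (h : IsTypeFP n Γ) :
    ∃ X : BasedComplex.{u, u} (GroupRing Γ), IsResolution X.complex ∧
      (∀ j, Nonempty (X.index j)) ∧ ∀ j ≤ n, Finite (X.index j) := by
  let S : Syzygy (GroupRing Γ) := ⟨ModuleCat.of _ (ULift.{u} (TrivialModule Γ)), n + 1,
    h.hasFiniteProjectiveResolution.hasFiniteFreeResolution⟩
  refine ⟨S.resolution, ⟨fun j => ?_, ?_⟩, fun j => (S.iter j).cover_spec.1, fun j hj => ?_⟩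
  · rw [S.resolution_d, S.resolution_d]
    exact S.exact_differential j
  · refine ⟨ULift.moduleEquiv.toLinearMap ∘ₗ S.cover, ?_,
      (ULift.moduleEquiv (R := GroupRing Γ)).surjective.comp S.cover_spec.2.2.1⟩
    rw [S.resolution_d]
    intro x
    refine Iff.trans ?_ (S.exact_cover x)
    exact (ULift.moduleEquiv (R := GroupRing Γ)).map_eq_zero_iff
  · refine (S.iter j).cover_spec.2.1 ?_
    rw [S.length_iter]
    change 0 < n + 1 - j
    omega

end TypeFP

/-! ### Contractions of resolutions -/

section Contraction

variable {Γ : Type u} [Group Γ]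

/-- Freeness over ℤ is what allows additive, non-equivariant contractions to be built by lifting. -/
theorem free_int_of_basis {ι : Type*} {M : Type*} [AddCommGroup M] [Module (GroupRing Γ) M]
    (b : Module.Basis ι (GroupRing Γ) M) : Module.Free ℤ M := by
  have : Module.Free (GroupRing Γ) M := Module.Free.of_basis b
  have : Module.Free ℤ (GroupRing Γ) :=
    Module.Free.of_equiv (MonoidAlgebra.coeffAddEquiv (R := ℤ) (M := Γ)).symm.toIntLinearEquiv
  exact Module.Free.trans (S := GroupRing Γ)

/-- Lifting property of a free module with respect to an exact pair of homomorphisms. -/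
theorem exists_lift_of_exact {A B C F : Type*} [AddCommGroup A] [AddCommGroup B] [AddCommGroup C]
    [AddCommGroup F] [Module.Free ℤ F] (f : A →ₗ[ℤ] B) (g : B →ₗ[ℤ] C)
    (hfg : Function.Exact f g) (φ : F →ₗ[ℤ] B) (hφ : ∀ x, g (φ x) = 0) :
    ∃ h : F →ₗ[ℤ] A, ∀ x, f (h x) = φ x := by
  have hmem : ∀ a, f a ∈ LinearMap.ker g := fun a => hfg.apply_apply_eq_zero a
  obtain ⟨h, hh⟩ := Module.projective_lifting_property (f.codRestrict (LinearMap.ker g) hmem)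
    (φ.codRestrict (LinearMap.ker g) hφ) (by
      rintro ⟨b, hb⟩
      obtain ⟨a, rfl⟩ := (hfg b).1 hb
      exact ⟨a, rfl⟩)
  exact ⟨h, fun z => congrArg Subtype.val (LinearMap.congr_fun hh z)⟩

/-- A free resolution of the trivial module has an additive contraction. -/
theorem exists_contraction (X : BasedComplex.{u, u} (GroupRing Γ))
    (ε : X.complex.X 0 →ₗ[GroupRing Γ] TrivialModule Γ)
    (hex : ∀ j, Function.Exact (X.complex.d (j + 2) (j + 1)).hom (X.complex.d (j + 1) j).hom)
    (hε : Function.Exact (X.complex.d 1 0).hom ε) (hsurj : Function.Surjective ε) :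
    ∃ (h : ∀ j, X.complex.X j →ₗ[ℤ] X.complex.X (j + 1)) (η : TrivialModule Γ →ₗ[ℤ] X.complex.X 0),
      (∀ x, X.complex.d 1 0 (h 0 x) = x - η (ε x)) ∧
      ∀ j x, X.complex.d (j + 2) (j + 1) (h (j + 1) x) = x - h j (X.complex.d (j + 1) j x) := by
  have hfree : ∀ j, Module.Free ℤ (X.complex.X j) := fun j => free_int_of_basis (X.basis j)
  let D : ∀ j, X.complex.X (j + 1) →ₗ[ℤ] X.complex.X j :=
    fun j => (X.complex.d (j + 1) j).hom.toAddMonoidHom.toIntLinearMap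
  let E : X.complex.X 0 →ₗ[ℤ] TrivialModule Γ := ε.toAddMonoidHom.toIntLinearMap
  obtain ⟨η, hη⟩ : ∃ η : TrivialModule Γ →ₗ[ℤ] X.complex.X 0, ∀ z, ε (η z) = z := by
    have : Module.Free ℤ (TrivialModule Γ) :=
      Module.Free.of_equiv (AddEquiv.refl ℤ : ℤ ≃+ TrivialModule Γ).toIntLinearEquiv
    obtain ⟨η, hη⟩ := Module.projective_lifting_property E LinearMap.id hsurj
    exact ⟨η, fun z => LinearMap.congr_fun hη z⟩
  obtain ⟨h₀, hh₀⟩ := exists_lift_of_exact (D 0) E hε (LinearMap.id - η ∘ₗ E) (fun x => by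
    change ε (x - η (ε x)) = 0
    rw [map_sub, hη, sub_self])
  replace hh₀ : ∀ x, D 0 (h₀ x) = x - η (ε x) := hh₀
  have hDD : ∀ j x, D j (D (j + 1) x) = 0 := fun j x => (hex j).apply_apply_eq_zero x
  -- The invariant DhD = D of the recursion says that x - h(Dx) is a cycle, hence can be lifted by
  -- exactness.
  let P : ∀ j, (X.complex.X j →ₗ[ℤ] X.complex.X (j + 1)) → Prop :=
    fun j h => ∀ x, D j (h (D j x)) = D j x
  have hstep : ∀ j (h : {h // P j h}), ∃ h' : {h // P (j + 1) h},
      ∀ x, D (j + 1) (h'.1 x) = x - h.1 (D j x) := by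
    rintro j ⟨h, hP⟩
    obtain ⟨h', hh'⟩ := exists_lift_of_exact (D (j + 1)) (D j) (hex j)
      (LinearMap.id - h ∘ₗ D j) (fun x => by
        change D j (x - h (D j x)) = 0
        rw [map_sub, hP, sub_self])
    replace hh' : ∀ x, D (j + 1) (h' x) = x - h (D j x) := hh'
    exact ⟨⟨h', fun x => by rw [hh', hDD, map_zero, sub_zero]⟩, hh'⟩
  choose next hnext using hstep
  let h : ∀ j, {h // P j h} := Nat.rec
    ⟨h₀, fun x => by rw [hh₀, show ε (D 0 x) = 0 from hε.apply_apply_eq_zero x, map_zero,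
      sub_zero]⟩ next
  exact ⟨fun j => (h j).1, η, hh₀, fun j x => hnext j (h j) x⟩

end Contraction

end CheapRebuilding
end

noncomputable section
namespace CheapRebuilding

/-! ### Norms of homomorphisms of based free modules -/

section Norm

variable {ι κ : Type*} {M L : Type*} [AddCommGroup M] [Module ℤ M] [AddCommGroup L] [Module ℤ L]
  (b : Module.Basis ι ℤ M) (c : Module.Basis κ ℤ L)

@[simp]
theorem l1Norm_zero : l1Norm b 0 = 0 := by
  simp [l1Norm]

theorem l1Norm_add_le (x y : M) : l1Norm b (x + y) ≤ l1Norm b x + l1Norm b y := by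
  classical
  have h : ∀ z : M, (b.repr z).support ⊆ (b.repr x).support ∪ (b.repr y).support →
      l1Norm b z = ∑ i ∈ (b.repr x).support ∪ (b.repr y).support, ((b.repr z i).natAbs : ℝ≥0) :=
    fun z hz => Finsupp.sum_of_support_subset _ hz _ (by simp)
  rw [h x Finset.subset_union_left, h y Finset.subset_union_right,
    h (x + y) (by rw [map_add]; exact Finsupp.support_add), ← Finset.sum_add_distrib]
  refine Finset.sum_le_sum fun i _ => ?_
  rw [map_add, Finsupp.add_apply]
  exact_mod_cast Int.natAbs_add_le _ _

theorem l1Norm_smul (z : ℤ) (x : M) : l1Norm b (z • x) = z.natAbs * l1Norm b x := by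
  rcases eq_or_ne z 0 with rfl | hz
  · simp
  rw [l1Norm, l1Norm, map_zsmul, Finsupp.sum_smul_index' (by simp), Finsupp.mul_sum]
  simp [Int.natAbs_mul]

@[simp]
theorem l1Norm_basis (i : ι) : l1Norm b (b i) = 1 := by
  simp [l1Norm]

theorem l1Norm_map_le (f : M →ₗ[ℤ] L) {C : ℝ≥0} (hC : ∀ i, l1Norm c (f (b i)) ≤ C) (m : M) :
    l1Norm c (f m) ≤ C * l1Norm b m := by
  classical
  have hsum : ∀ (s : Finset ι) (g : ι → L), l1Norm c (∑ i ∈ s, g i) ≤ ∑ i ∈ s, l1Norm c (g i) :=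
    fun s g => Finset.le_sum_of_subadditive _ (l1Norm_zero c).le (l1Norm_add_le c) s g
  conv_lhs => rw [← b.linearCombination_repr m, Finsupp.linearCombination_apply, Finsupp.sum,
    map_sum]
  refine (hsum _ _).trans ?_
  rw [l1Norm, Finsupp.sum, Finset.mul_sum]
  refine Finset.sum_le_sum fun i _ => ?_
  refine (congrArg (fun y => l1Norm c (f y))
    (int_smul_eq_zsmul _ (b.repr m i) (b i))).trans_le ?_
  rw [map_zsmul, l1Norm_smul, mul_comm]
  gcongr
  exact hC i

theorem l1OpNorm_le (f : M →ₗ[ℤ] L) {C : ℝ≥0} (hC : ∀ i, l1Norm c (f (b i)) ≤ C) :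
    l1OpNorm b c f ≤ C :=
  iInf₂_le C (l1Norm_map_le b c f hC)

end Norm

/-! ### Lifting coinvariants along a section -/

section Lift

variable {Γ : Type u} [Group Γ] (Λ : Subgroup Γ) {ι : Type w} {M : Type v} [AddCommGroup M]
  [Module (GroupRing Γ) M] (b : Module.Basis ι (GroupRing Γ) M)

theorem coinvariantsBasis_mk (i : ι) (γ : Γ) :
    coinvariantsBasis Λ b (i, Quotient.mk _ γ) =
      (coinvariantsKer Λ M).mkQ (MonoidAlgebra.single γ (1 : ℤ) • b i) := by
  rw [coinvariantsBasis, Module.Basis.mk_apply, coinvariantsFamily_mk]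

theorem single_eq_zsmul (γ : Γ) (z : ℤ) (m : M) :
    MonoidAlgebra.single γ z • m = z • (MonoidAlgebra.single γ (1 : ℤ) • m) := by
  rw [← smul_assoc, MonoidAlgebra.smul_single, smul_eq_mul, mul_one]

/-- The norms of the classes of the translates of an element in all modules of coinvariants are
uniformly bounded. -/
theorem exists_l1Norm_mkQ_le (m : M) : ∃ C : ℝ≥0, ∀ (Λ : Subgroup Γ) (γ : Γ),
    l1Norm (coinvariantsBasis Λ b)
      ((coinvariantsKer Λ M).mkQ (MonoidAlgebra.single γ (1 : ℤ) • m)) ≤ C := by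
  induction m using basis_induction b with
  | zero => exact ⟨0, fun Λ γ => by simp⟩
  | add x y hx hy =>
    obtain ⟨C, hC⟩ := hx
    obtain ⟨D, hD⟩ := hy
    refine ⟨C + D, fun Λ γ => ?_⟩
    rw [smul_add, map_add]
    exact (l1Norm_add_le _ _ _).trans (add_le_add (hC Λ γ) (hD Λ γ))
  | single i δ z =>
    refine ⟨z.natAbs, fun Λ γ => ?_⟩
    rw [smul_smul, MonoidAlgebra.single_mul_single, one_mul, single_eq_zsmul, map_zsmul,
      ← coinvariantsBasis_mk, l1Norm_smul, l1Norm_basis, mul_one]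

/-- The subgroup generated by the translates of basis elements by elements of `S`. -/
def translateSpan (S : Finset Γ) : Submodule ℤ M :=
  Submodule.span ℤ {x | ∃ w ∈ S, ∃ i, x = MonoidAlgebra.single w (1 : ℤ) • b i}

theorem translateSpan_mono {S T : Finset Γ} (h : S ⊆ T) : translateSpan b S ≤ translateSpan b T :=
  Submodule.span_mono fun _ ⟨w, hw, i, hx⟩ => ⟨w, h hw, i, hx⟩

theorem exists_mem_translateSpan (m : M) : ∃ S : Finset Γ, m ∈ translateSpan b S := by
  classical
  induction m using basis_induction b with
  | zero => exact ⟨∅, Submodule.zero_mem _⟩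
  | add x y hx hy =>
    obtain ⟨S, hS⟩ := hx
    obtain ⟨T, hT⟩ := hy
    exact ⟨S ∪ T, Submodule.add_mem _ (translateSpan_mono b Finset.subset_union_left hS)
      (translateSpan_mono b Finset.subset_union_right hT)⟩
  | single i γ z =>
    refine ⟨{γ}, ?_⟩
    rw [single_eq_zsmul]
    exact Submodule.smul_mem _ _ (Submodule.subset_span ⟨γ, Finset.mem_singleton_self γ, i, rfl⟩)

/-- The additive section `M_Λ → M` induced by a section `ℓ` of `Γ → Λ \ Γ`. -/
def sectionLift (ℓ : Quotient (QuotientGroup.rightRel Λ) → Γ) : Coinvariants Λ M →ₗ[ℤ] M :=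
  (coinvariantsBasis Λ b).constr ℤ fun p => MonoidAlgebra.single (ℓ p.2) (1 : ℤ) • b p.1

variable {Λ} {ℓ : Quotient (QuotientGroup.rightRel Λ) → Γ}

theorem sectionLift_basis (p : ι × Quotient (QuotientGroup.rightRel Λ)) :
    sectionLift Λ b ℓ (coinvariantsBasis Λ b p) =
      MonoidAlgebra.single (ℓ p.2) (1 : ℤ) • b p.1 :=
  Module.Basis.constr_basis _ _ _ _

theorem mkQ_sectionLift (hℓ : ∀ x, Quotient.mk _ (ℓ x) = x) (y : Coinvariants Λ M) :
    (coinvariantsKer Λ M).mkQ (sectionLift Λ b ℓ y) = y := by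
  have : (coinvariantsKer Λ M).mkQ ∘ₗ sectionLift Λ b ℓ = LinearMap.id := by
    refine (coinvariantsBasis Λ b).ext fun p => ?_
    rw [LinearMap.comp_apply, sectionLift_basis, ← coinvariantsBasis_mk, hℓ, LinearMap.id_apply]
  exact LinearMap.congr_fun this y

/-- The section is compatible with translates at points where `ℓ` is equivariant. -/
theorem sectionLift_mkQ {S : Finset Γ} {m : M} (hm : m ∈ translateSpan b S) {γ : Γ}
    (hγ : ∀ w ∈ S, ℓ (Quotient.mk _ (γ * w)) = γ * w) :
    sectionLift Λ b ℓ ((coinvariantsKer Λ M).mkQ (MonoidAlgebra.single γ (1 : ℤ) • m)) =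
      MonoidAlgebra.single γ (1 : ℤ) • m := by
  induction hm using Submodule.span_induction with
  | mem x hx =>
    obtain ⟨w, hw, i, rfl⟩ := hx
    rw [smul_smul, MonoidAlgebra.single_mul_single, one_mul, ← coinvariantsBasis_mk,
      sectionLift_basis, hγ w hw]
  | zero => simp
  | add x y _ _ hx hy => rw [smul_add, map_add, map_add, hx, hy]
  | smul z x _ hx => rw [smul_comm, map_zsmul, map_zsmul, hx]

/-- Support control: translating by γ moves the support of m into γS. It is used to keep boundaries
of good basis elements inside the good part. -/
theorem mkQ_smul_mem_span {S : Finset Γ} {m : M} (hm : m ∈ translateSpan b S) {γ : Γ}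
    {A : Set (Quotient (QuotientGroup.rightRel Λ))}
    (hγ : ∀ w ∈ S, Quotient.mk _ (γ * w) ∈ A) :
    (coinvariantsKer Λ M).mkQ (MonoidAlgebra.single γ (1 : ℤ) • m) ∈
      Submodule.span ℤ (coinvariantsBasis Λ b '' {p | p.2 ∈ A}) := by
  induction hm using Submodule.span_induction with
  | mem x hx =>
    obtain ⟨w, hw, i, rfl⟩ := hx
    rw [smul_smul, MonoidAlgebra.single_mul_single, one_mul, ← coinvariantsBasis_mk]
    exact Submodule.subset_span ⟨_, hγ w hw, rfl⟩
  | zero => simp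
  | add x y _ _ hx hy =>
    rw [smul_add, map_add]
    exact Submodule.add_mem _ hx hy
  | smul z x _ hx =>
    rw [smul_comm, map_zsmul]
    exact Submodule.smul_mem _ _ hx

end Lift

/-! ### Collapsing a subcomplex to a point -/

/-- Data for collapsing the subcomplex spanned by a set of basis elements: an endomorphism `φ`
which is homotopic to the identity and which on the subcomplex is given by `x ↦ coeff x • point`. -/
structure Collapse (Y : BasedComplex.{0, v} ℤ) where
  /-- the basis elements that are collapsed -/
  set : ∀ j, Set (Y.index j)
  /-- the augmentation -/
  coeff : ∀ j, Y.complex.X j →ₗ[ℤ] ℤ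
  /-- the point to which the subcomplex is collapsed -/
  point : ∀ j, Y.complex.X j
  /-- the endomorphism -/
  φ : Y.complex ⟶ Y.complex
  /-- the homotopy to the endomorphism -/
  homotopy : Homotopy (𝟙 Y.complex) φ
  d_mem : ∀ j, ∀ p ∈ set (j + 1), (Y.complex.d (j + 1) j).hom (Y.basis (j + 1) p) ∈
    Submodule.span ℤ (Y.basis j '' set j)
  coeff_d : ∀ j, ∀ p ∈ set (j + 1), coeff j ((Y.complex.d (j + 1) j).hom (Y.basis (j + 1) p)) = 0
  d_point : ∀ j, (Y.complex.d (j + 1) j).hom (point (j + 1)) = 0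
  φ_basis : ∀ j, ∀ p ∈ set j, (φ.f j).hom (Y.basis j p) = coeff j (Y.basis j p) • point j

namespace Collapse

variable {Y : BasedComplex.{0, v} ℤ} (c : Collapse Y)

/-- The index type of the collapsed complex. -/
abbrev index (j : ℕ) : Type v := Option ↥(c.set j)ᶜ

open Classical in
/-- The projection to the collapsed complex. -/
def proj (j : ℕ) : Y.complex.X j →ₗ[ℤ] (c.index j →₀ ℤ) :=
  (Y.basis j).constr ℤ fun p =>
    if h : p ∈ c.set j then Finsupp.single none (c.coeff j (Y.basis j p))
    else Finsupp.single (some ⟨p, h⟩) 1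

/-- The inclusion of the basis elements that are not collapsed. -/
def incl (j : ℕ) : (c.index j →₀ ℤ) →ₗ[ℤ] Y.complex.X j :=
  Finsupp.basisSingleOne.constr ℕ fun o => o.elim 0 fun p => Y.basis j p

/-- The homotopy inverse of the projection. -/
def inv (j : ℕ) : (c.index j →₀ ℤ) →ₗ[ℤ] Y.complex.X j :=
  Finsupp.basisSingleOne.constr ℕ fun o => o.elim (c.point j) fun p => (c.φ.f j).hom (Y.basis j p)

theorem incl_single (j : ℕ) (o : c.index j) :
    c.incl j (Finsupp.single o 1) = o.elim 0 fun p => Y.basis j p :=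
  (congrArg (c.incl j) (congrFun Finsupp.coe_basisSingleOne o).symm).trans
    (Module.Basis.constr_basis _ _ _ _)

theorem inv_single (j : ℕ) (o : c.index j) :
    c.inv j (Finsupp.single o 1) =
      o.elim (c.point j) fun p => (c.φ.f j).hom (Y.basis j p) :=
  (congrArg (c.inv j) (congrFun Finsupp.coe_basisSingleOne o).symm).trans
    (Module.Basis.constr_basis _ _ _ _)

theorem single_none (j : ℕ) (z : ℤ) :
    (Finsupp.single none z : c.index j →₀ ℤ) = z • Finsupp.single none 1 := by
  rw [Finsupp.smul_single, smul_eq_mul, mul_one]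

/-- The differential of the collapsed complex. -/
def differential (j : ℕ) : (c.index (j + 1) →₀ ℤ) →ₗ[ℤ] (c.index j →₀ ℤ) :=
  c.proj j ∘ₗ (Y.complex.d (j + 1) j).hom ∘ₗ c.incl (j + 1)

theorem proj_of_mem {j : ℕ} {p : Y.index j} (hp : p ∈ c.set j) :
    c.proj j (Y.basis j p) = Finsupp.single none (c.coeff j (Y.basis j p)) := by
  rw [proj, Module.Basis.constr_basis, dif_pos hp]

theorem proj_of_notMem {j : ℕ} {p : Y.index j} (hp : p ∉ c.set j) :
    c.proj j (Y.basis j p) = Finsupp.single (some ⟨p, hp⟩) 1 := by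
  rw [proj, Module.Basis.constr_basis, dif_neg hp]

theorem proj_of_mem_span {j : ℕ} {y : Y.complex.X j}
    (hy : y ∈ Submodule.span ℤ (Y.basis j '' c.set j)) :
    c.proj j y = Finsupp.single none (c.coeff j y) := by
  induction hy using Submodule.span_induction with
  | mem x hx =>
    obtain ⟨p, hp, rfl⟩ := hx
    exact c.proj_of_mem hp
  | zero => simp
  | add x y _ _ hx hy => rw [map_add, map_add, hx, hy, Finsupp.single_add]
  | smul z x _ hx =>
    rw [LinearMap.map_smul, LinearMap.map_smul, hx, Finsupp.smul_single]

theorem incl_proj_of_notMem {j : ℕ} {p : Y.index j} (hp : p ∉ c.set j) :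
    c.incl j (c.proj j (Y.basis j p)) = Y.basis j p := by
  rw [c.proj_of_notMem hp, incl_single]
  rfl

/-- On collapsed elements both sides vanish, by `coeff_d` and because `incl` kills the extra
generator; on the others `incl ∘ proj` is the identity. -/
theorem differential_proj (j : ℕ) :
    c.differential j ∘ₗ c.proj (j + 1) = c.proj j ∘ₗ (Y.complex.d (j + 1) j).hom := by
  refine (Y.basis (j + 1)).ext fun p => ?_
  simp only [differential, LinearMap.comp_apply]
  by_cases hp : p ∈ c.set (j + 1)
  · rw [c.proj_of_mem_span (c.d_mem j p hp), c.coeff_d j p hp, c.proj_of_mem hp,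
      single_none, map_zsmul, incl_single]
    simp
  · rw [c.incl_proj_of_notMem hp]

/-- By `φ_basis`, φ factors through the collapse; its homotopy to the identity thus becomes the
homotopy of the retract. -/
theorem inv_proj (j : ℕ) : c.inv j ∘ₗ c.proj j = (c.φ.f j).hom := by
  refine (Y.basis j).ext fun p => ?_
  rw [LinearMap.comp_apply]
  by_cases hp : p ∈ c.set j
  · rw [c.proj_of_mem hp, c.φ_basis j p hp, single_none, map_zsmul,
      inv_single]
    rfl
  · rw [c.proj_of_notMem hp, inv_single]
    rfl

theorem d_comp_d (j : ℕ) :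
    (Y.complex.d (j + 1) j).hom ∘ₗ (Y.complex.d (j + 2) (j + 1)).hom = 0 := by
  rw [← ModuleCat.hom_comp, Y.complex.d_comp_d]
  rfl

theorem differential_comp_differential (j : ℕ) :
    c.differential j ∘ₗ c.differential (j + 1) = 0 := by
  have h : c.differential j ∘ₗ c.differential (j + 1) =
      (c.differential j ∘ₗ c.proj (j + 1)) ∘ₗ (Y.complex.d (j + 2) (j + 1)).hom ∘ₗ
        c.incl (j + 2) := rfl
  rw [h, differential_proj, LinearMap.comp_assoc, ← LinearMap.comp_assoc (c.incl (j + 2)),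
    d_comp_d, LinearMap.zero_comp, LinearMap.comp_zero]

theorem d_comp_inv (j : ℕ) :
    (Y.complex.d (j + 1) j).hom ∘ₗ c.inv (j + 1) = c.inv j ∘ₗ c.differential j := by
  have hφ : (Y.complex.d (j + 1) j).hom ∘ₗ (c.φ.f (j + 1)).hom =
      (c.φ.f j).hom ∘ₗ (Y.complex.d (j + 1) j).hom := by
    rw [← ModuleCat.hom_comp, ← ModuleCat.hom_comp, c.φ.comm]
  have h : c.inv j ∘ₗ c.differential j =
      (Y.complex.d (j + 1) j).hom ∘ₗ (c.φ.f (j + 1)).hom ∘ₗ c.incl (j + 1) := by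
    rw [differential, ← LinearMap.comp_assoc, inv_proj, ← LinearMap.comp_assoc, ← hφ,
      LinearMap.comp_assoc]
  rw [h]
  refine Finsupp.lhom_ext' fun o => LinearMap.ext_ring ?_
  simp only [LinearMap.comp_apply, Finsupp.lsingle_apply, inv_single, incl_single]
  cases o with
  | none => simp [c.d_point]
  | some p => rfl

/-- The collapsed complex. -/
def complex : BasedComplex.{0, v} ℤ where
  complex := ChainComplex.of (fun j => ModuleCat.of ℤ (c.index j →₀ ℤ))
    (fun j => ModuleCat.ofHom (c.differential j)) (fun j => by
      rw [← ModuleCat.ofHom_comp, differential_comp_differential]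
      rfl)
  index j := c.index j
  basis j := Finsupp.basisSingleOne

theorem complex_d (j : ℕ) :
    c.complex.complex.d (j + 1) j = ModuleCat.ofHom (c.differential j) :=
  ChainComplex.of_d (fun j => ModuleCat.of ℤ (c.index j →₀ ℤ))
    (fun j => ModuleCat.ofHom (c.differential j)) j

/-- The collapsed complex is a homotopy retract. -/
def homotopyRetract : HomotopyRetract Y.complex c.complex.complex where
  toFun :=
    { f j := ModuleCat.ofHom (c.proj j)
      comm' := by
        rintro _ j rfl
        rw [complex_d]
        exact ModuleCat.hom_ext (c.differential_proj j) }
  invFun :=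
    { f j := ModuleCat.ofHom (c.inv j)
      comm' := by
        rintro _ j rfl
        rw [complex_d]
        exact ModuleCat.hom_ext (c.d_comp_inv j) }
  homotopy := c.homotopy.trans (Homotopy.ofEq (by
    ext j : 1
    exact ModuleCat.hom_ext (c.inv_proj j).symm))

theorem l1Norm_proj_le {j : ℕ} {K : ℝ≥0} (hK : 1 ≤ K)
    (hcoeff : ∀ p ∈ c.set j, ((c.coeff j (Y.basis j p)).natAbs : ℝ≥0) ≤ K) (y : Y.complex.X j) :
    l1Norm (c.complex.basis j) (c.proj j y) ≤ K * l1Norm (Y.basis j) y := by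
  have hsingle : ∀ (o : c.index j) (z : ℤ),
      l1Norm (Finsupp.basisSingleOne (R := ℤ) (ι := c.index j)) (Finsupp.single o z) =
        z.natAbs := by
    intro o z
    simp [l1Norm]
  refine l1Norm_map_le _ (Finsupp.basisSingleOne (R := ℤ) (ι := c.index j)) _ (fun p => ?_) y
  by_cases hp : p ∈ c.set j
  · rw [c.proj_of_mem hp, hsingle]
    exact hcoeff p hp
  · rw [c.proj_of_notMem hp, hsingle]
    simpa using hK

theorem l1OpNorm_toFun_le {j : ℕ} {K : ℝ≥0} (hK : 1 ≤ K)
    (hcoeff : ∀ p ∈ c.set j, ((c.coeff j (Y.basis j p)).natAbs : ℝ≥0) ≤ K) :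
    l1OpNorm (Y.basis j) (c.complex.basis j) (c.homotopyRetract.toFun.f j).hom ≤ K :=
  iInf₂_le K (c.l1Norm_proj_le hK hcoeff)

/-- The collapsed differential is `proj ∘ d ∘ incl`, and `incl` sends basis elements to basis
elements or to 0. Neither φ nor the homotopy enters. -/
theorem l1OpNorm_d_le {j : ℕ} {K D : ℝ≥0} (hK : 1 ≤ K)
    (hcoeff : ∀ p ∈ c.set j, ((c.coeff j (Y.basis j p)).natAbs : ℝ≥0) ≤ K)
    (hD : ∀ p, l1Norm (Y.basis j) ((Y.complex.d (j + 1) j).hom (Y.basis (j + 1) p)) ≤ D) :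
    l1OpNorm (c.complex.basis (j + 1)) (c.complex.basis j) (c.complex.complex.d (j + 1) j).hom ≤
      ↑(K * D) := by
  have key : ∀ o : c.index (j + 1), l1Norm (c.complex.basis j)
      (c.proj j ((Y.complex.d (j + 1) j).hom (c.incl (j + 1) (Finsupp.single o 1)))) ≤ K * D := by
    intro o
    refine (c.l1Norm_proj_le hK hcoeff _).trans ?_
    gcongr
    rw [incl_single]
    cases o with
    | none => simp
    | some p => exact hD p
  rw [complex_d]
  refine l1OpNorm_le (Finsupp.basisSingleOne (R := ℤ) (ι := c.index (j + 1)))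
    (c.complex.basis j) (c.differential j) fun o => ?_
  rw [Finsupp.coe_basisSingleOne]
  exact key o

theorem finite_complex {j : ℕ} (h : Finite (Y.index j)) :
    Module.Finite ℤ (c.complex.complex.X j) :=
  inferInstanceAs (Module.Finite ℤ (c.index j →₀ ℤ))

theorem finrank_complex {j : ℕ} (h : Finite (Y.index j)) :
    Module.finrank ℤ (c.complex.complex.X j) = Nat.card ↥(c.set j)ᶜ + 1 := by
  rw [Module.finrank_eq_nat_card_basis (c.complex.basis j)]
  exact Finite.card_option

end Collapse

end CheapRebuilding
end

noncomputable section
namespace CheapRebuilding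

/-! ### Collapsing the interior of a section -/

/-- The endomorphism of a chain complex obtained by subtracting a null homotopic map from the
identity. -/
theorem exists_homotopy_id (Y : ChainComplex (ModuleCat.{v} ℤ) ℕ)
    (H : ∀ j, Y.X j →ₗ[ℤ] Y.X (j + 1)) :
    ∃ φ : Y ⟶ Y, Nonempty (Homotopy (𝟙 Y) φ) ∧
      (∀ x, (φ.f 0).hom x = x - (Y.d 1 0).hom (H 0 x)) ∧
      ∀ j x, (φ.f (j + 1)).hom x =
        x - (H j ((Y.d (j + 1) j).hom x) + (Y.d (j + 2) (j + 1)).hom (H (j + 1) x)) := by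
  let h : ∀ i j, (ComplexShape.down ℕ).Rel j i → (Y.X i ⟶ Y.X j) := fun i j hij =>
    ModuleCat.ofHom (H i) ≫ eqToHom (congrArg Y.X hij)
  have hh : ∀ i, h i (i + 1) rfl = ModuleCat.ofHom (H i) := fun i => Category.comp_id _
  refine ⟨𝟙 Y - Homotopy.nullHomotopicMap' h,
    ⟨(Homotopy.equivSubZero.symm ((Homotopy.ofEq (by abel)).trans
      (Homotopy.nullHomotopy' h)))⟩, fun x => ?_, fun j x => ?_⟩
  · rw [HomologicalComplex.sub_f_apply, Homotopy.nullHomotopicMap'_f_of_not_rel_left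
      (k₁ := 1) (k₀ := 0) rfl (fun l hl => by simp at hl), hh]
    rfl
  · rw [HomologicalComplex.sub_f_apply, Homotopy.nullHomotopicMap'_f
      (k₂ := j + 2) (k₁ := j + 1) (k₀ := j) rfl rfl, hh, hh]
    rfl

section

variable {Γ : Type u} [Group Γ]

theorem single_smul_trivialModule (γ : Γ) (z : TrivialModule Γ) :
    (MonoidAlgebra.single γ (1 : ℤ) : GroupRing Γ) • z = z := by
  rw [Representation.single_smul, one_smul]
  rfl

/-- The augmentation on the coinvariants. -/
def coinvariantsAugmentation (Λ : Subgroup Γ) {M : Type v} [AddCommGroup M]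
    [Module (GroupRing Γ) M] (ε : M →ₗ[GroupRing Γ] TrivialModule Γ) : Coinvariants Λ M →ₗ[ℤ] ℤ :=
  (coinvariantsKer Λ M).liftQ
    (ε.toAddMonoidHom.toIntLinearMap : M →ₗ[ℤ] TrivialModule Γ) (by
      refine Submodule.span_le.2 ?_
      rintro x ⟨g, -, m, rfl⟩
      change ε (_ - _) = 0
      rw [map_sub, map_smul, single_smul_trivialModule, sub_self])

theorem coinvariantsAugmentation_mkQ (Λ : Subgroup Γ) {M : Type v} [AddCommGroup M]
    [Module (GroupRing Γ) M] (ε : M →ₗ[GroupRing Γ] TrivialModule Γ) (m : M) :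
    coinvariantsAugmentation Λ ε ((coinvariantsKer Λ M).mkQ m) = ε m := rfl

variable (Λ : Subgroup Γ) (X : BasedComplex.{u, u} (GroupRing Γ))

theorem coinvariants_d_mkQ (i j : ℕ) (x : X.complex.X i) :
    ((X.coinvariants Λ).complex.d i j).hom ((coinvariantsKer Λ (X.complex.X i)).mkQ x) =
      (coinvariantsKer Λ (X.complex.X j)).mkQ ((X.complex.d i j).hom x) := rfl

theorem coinvariants_d_basis (j : ℕ) (i : X.index (j + 1)) (γ : Γ) :
    ((X.coinvariants Λ).complex.d (j + 1) j).hom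
        ((X.coinvariants Λ).basis (j + 1) (i, Quotient.mk _ γ)) =
      (coinvariantsKer Λ (X.complex.X j)).mkQ (MonoidAlgebra.single γ (1 : ℤ) •
        (X.complex.d (j + 1) j).hom (X.basis (j + 1) i)) := by
  rw [← map_smul, ← coinvariants_d_mkQ, ← coinvariantsBasis_mk]
  rfl

variable {Λ X}

/-- The basis elements of `X_Λ` over the points where the section `ℓ` is equivariant with respect to
`W j`, in degrees `j ≤ n`. -/
def interior (Λ : Subgroup Γ) (X : BasedComplex.{u, u} (GroupRing Γ)) (n : ℕ) (W : ℕ → Finset Γ)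
    (ℓ : Quotient (QuotientGroup.rightRel Λ) → Γ) (j : ℕ) :
    Set (X.index j × Quotient (QuotientGroup.rightRel Λ)) :=
  {p | j ≤ n ∧ ∀ w ∈ W j, ℓ (Quotient.mk _ (ℓ p.2 * w)) = ℓ p.2 * w}

open Classical in
/-- The interior of a section can be collapsed to a point. -/
theorem exists_collapse {n : ℕ} {S : Finset Γ} {W : ℕ → Finset Γ}
    (hSW : ∀ j, S ⊆ W (j + 1)) (hW : ∀ j, ∀ w ∈ S, ∀ w' ∈ W j, w * w' ∈ W (j + 1))
    {ℓ : Quotient (QuotientGroup.rightRel Λ) → Γ} (hℓ : ∀ x, Quotient.mk _ (ℓ x) = x)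
    (hS : ∀ j, j + 1 ≤ n → ∀ i, (X.complex.d (j + 1) j).hom (X.basis (j + 1) i) ∈
      translateSpan (X.basis j) S)
    (ε : X.complex.X 0 →ₗ[GroupRing Γ] TrivialModule Γ)
    (hex : ∀ j, Function.Exact (X.complex.d (j + 2) (j + 1)).hom (X.complex.d (j + 1) j).hom)
    (hε : Function.Exact (X.complex.d 1 0).hom ε) (hsurj : Function.Surjective ε) :
    ∃ c : Collapse (X.coinvariants Λ), c.set = interior Λ X n W ℓ ∧
      c.coeff 0 = coinvariantsAugmentation Λ ε ∧ ∀ j, c.coeff (j + 1) = 0 := by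
  obtain ⟨h, η, h_zero, h_succ⟩ := exists_contraction X ε hex hε hsurj
  -- Nothing is collapsed above degree n, since `S` controls the supports of the differentials only
  -- up to there.
  let B := interior Λ X n W ℓ
  let b : ∀ j, Module.Basis (X.index j × Quotient (QuotientGroup.rightRel Λ)) ℤ
    (Coinvariants Λ (X.complex.X j)) := fun j => coinvariantsBasis Λ (X.basis j)
  let p : ∀ j, Coinvariants Λ (X.complex.X j) →ₗ[ℤ] Coinvariants Λ (X.complex.X j) :=
    fun j => (b j).constr ℤ fun p => if p ∈ B j then b j p else 0
  let lift : ∀ j, Coinvariants Λ (X.complex.X j) →ₗ[ℤ] X.complex.X j :=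
    fun j => sectionLift Λ (X.basis j) ℓ
  -- Discard the bad basis elements, lift along ℓ, contract in X, and project back.
  let H : ∀ j, Coinvariants Λ (X.complex.X j) →ₗ[ℤ] Coinvariants Λ (X.complex.X (j + 1)) :=
    fun j => (coinvariantsKer Λ (X.complex.X (j + 1))).mkQ ∘ₗ h j ∘ₗ lift j ∘ₗ p j
  let d : ∀ j, Coinvariants Λ (X.complex.X (j + 1)) →ₗ[ℤ] Coinvariants Λ (X.complex.X j) :=
    fun j => coinvariantsMap Λ (X.complex.d (j + 1) j).hom
  have hd : ∀ j x, d j ((coinvariantsKer Λ _).mkQ x) =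
      (coinvariantsKer Λ _).mkQ ((X.complex.d (j + 1) j).hom x) := fun _ _ => rfl
  have hlift : ∀ j y, (coinvariantsKer Λ _).mkQ (lift j y) = y :=
    fun j y => mkQ_sectionLift (X.basis j) hℓ y
  have hp : ∀ j, ∀ y ∈ Submodule.span ℤ (b j '' B j), p j y = y := by
    intro j y hy
    induction hy using Submodule.span_induction with
    | mem x hx =>
      obtain ⟨q, hq, rfl⟩ := hx
      simp only [p, Module.Basis.constr_basis, if_pos hq]
    | zero => exact map_zero _
    | add x y _ _ hx hy => rw [map_add, hx, hy]
    | smul z x _ hx => rw [map_zsmul, hx]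
  have hmem : ∀ j, ∀ q ∈ B j, b j q ∈ Submodule.span ℤ (b j '' B j) :=
    fun j q hq => Submodule.subset_span ⟨q, hq, rfl⟩
  have hH : ∀ j, ∀ y ∈ Submodule.span ℤ (b j '' B j),
      H j y = (coinvariantsKer Λ _).mkQ (h j (lift j y)) := by
    intro j y hy
    simp only [H, LinearMap.comp_apply, hp j y hy]
  have hdb : ∀ j (q : X.index (j + 1) × Quotient (QuotientGroup.rightRel Λ)),
      d j (b (j + 1) q) = (coinvariantsKer Λ _).mkQ (MonoidAlgebra.single (ℓ q.2) (1 : ℤ) •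
        (X.complex.d (j + 1) j).hom (X.basis (j + 1) q.1)) := by
    rintro j ⟨i, x⟩
    have := coinvariants_d_basis Λ X j i (ℓ x)
    rwa [hℓ] at this
  -- A point good for `W (j + 1)` moves under `S` to points good for `W j`, as S·`W j` ⊆ `W (j +
  -- 1)`.
  have hd_mem : ∀ j, ∀ q ∈ B (j + 1), d j (b (j + 1) q) ∈ Submodule.span ℤ (b j '' B j) := by
    intro j q hq
    rw [hdb]
    refine Submodule.span_mono (Set.image_mono ?_) (mkQ_smul_mem_span (X.basis j)
      (A := {x | ∀ w ∈ W j, ℓ (Quotient.mk _ (ℓ x * w)) = ℓ x * w}) (hS j hq.1 q.1) ?_)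
    · exact fun r hr => ⟨(Nat.le_succ j).trans hq.1, hr⟩
    · intro w hw w' hw'
      rw [hq.2 w (hSW j hw), mul_assoc, hq.2 _ (hW j w hw w' hw')]
  have hd_lift : ∀ j, ∀ q ∈ B (j + 1), lift j (d j (b (j + 1) q)) =
      (X.complex.d (j + 1) j).hom (lift (j + 1) (b (j + 1) q)) := by
    intro j q hq
    rw [hdb]
    refine (sectionLift_mkQ (X.basis j) (hS j hq.1 q.1) fun w hw => hq.2 w (hSW j hw)).trans ?_
    rw [← map_smul]
    exact congrArg _ (sectionLift_basis (X.basis (j + 1)) q).symm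
  obtain ⟨φ, ⟨hφ⟩, hφ_zero, hφ_succ⟩ := exists_homotopy_id (X.coinvariants Λ).complex H
  -- Only degree 0 retains anything: on good elements, id - dh is ηε there, whereas id - hd - dh
  -- vanishes in positive degrees.
  let coeff : ∀ j, Coinvariants Λ (X.complex.X j) →ₗ[ℤ] ℤ
    | 0 => coinvariantsAugmentation Λ ε
    | _ + 1 => 0
  let one : TrivialModule Γ := (1 : ℤ)
  let point : ∀ j, Coinvariants Λ (X.complex.X j)
    | 0 => (coinvariantsKer Λ _).mkQ (η one)
    | _ + 1 => 0
  refine ⟨{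
    set := B
    coeff := coeff
    point := point
    φ := φ
    homotopy := hφ
    d_mem := hd_mem
    coeff_d := ?_
    d_point := fun j => map_zero _
    φ_basis := ?_ }, rfl, rfl, fun _ => rfl⟩
  · rintro (_ | j) q hq
    · change coinvariantsAugmentation Λ ε (d 0 (b 1 q)) = 0
      rw [← hlift 1 (b 1 q), hd, coinvariantsAugmentation_mkQ]
      exact hε.apply_apply_eq_zero _
    · rfl
  · rintro (_ | j) q hq
    · refine (hφ_zero _).trans ?_
      change b 0 q - d 0 (H 0 (b 0 q)) =
        coinvariantsAugmentation Λ ε (b 0 q) • (coinvariantsKer Λ _).mkQ (η one)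
      have h1 : coinvariantsAugmentation Λ ε (b 0 q) = ε (lift 0 (b 0 q)) := by
        rw [← coinvariantsAugmentation_mkQ Λ, hlift]
      have h2 : ∀ z : ℤ, η z = z • η one := by
        intro z
        rw [← map_zsmul]
        refine congrArg η ?_
        change z = z • (1 : ℤ)
        simp
      rw [hH 0 _ (hmem 0 q hq), hd, h_zero, map_sub, hlift, sub_sub_cancel, h1]
      exact (congrArg _ (h2 _)).trans (map_zsmul _ _ _)
    · refine (hφ_succ j _).trans ?_
      change b (j + 1) q - (H j (d j (b (j + 1) q)) + d (j + 1) (H (j + 1) (b (j + 1) q))) =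
        (0 : ℤ) • (0 : Coinvariants Λ (X.complex.X (j + 1)))
      rw [hH j _ (hd_mem j q hq), hH (j + 1) _ (hmem (j + 1) q hq), hd, h_succ, map_sub, hlift,
        hd_lift j q hq, smul_zero]
      abel

end

end CheapRebuilding
end

noncomputable section
namespace CheapRebuilding

/-! ### The main theorem -/

section

variable {Γ : Type u} [Group Γ]

/-- `W j` is the set of products of at most j elements of S: each application of the differential
costs one factor. -/
theorem exists_iterated_products (S : Finset Γ) : ∃ W : ℕ → Finset Γ, (∀ j, S ⊆ W (j + 1)) ∧
    (∀ j, ∀ w ∈ S, ∀ w' ∈ W j, w * w' ∈ W (j + 1)) ∧ Monotone W := by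
  classical
  let W : ℕ → Finset Γ := Nat.rec {1} fun _ V => V ∪ Finset.image₂ (· * ·) S V
  have hsucc : ∀ j, W (j + 1) = W j ∪ Finset.image₂ (· * ·) S (W j) := fun _ => rfl
  have hmono : Monotone W := monotone_nat_of_le_succ fun j => by
    rw [hsucc]
    exact Finset.subset_union_left
  have hmul : ∀ j, ∀ w ∈ S, ∀ w' ∈ W j, w * w' ∈ W (j + 1) := by
    intro j w hw w' hw'
    rw [hsucc]
    exact Finset.mem_union_right _ (Finset.mem_image₂_of_mem hw hw')
  refine ⟨W, fun j w hw => ?_, hmul, hmono⟩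
  simpa using hmul j w hw 1 (hmono (Nat.zero_le j) (Finset.mem_singleton_self 1))

theorem coinvariantsAugmentation_basis {Λ : Subgroup Γ} {ι : Type w} {M : Type v} [AddCommGroup M]
    [Module (GroupRing Γ) M] (b : Module.Basis ι (GroupRing Γ) M)
    (ε : M →ₗ[GroupRing Γ] TrivialModule Γ) (i : ι) (x : Quotient (QuotientGroup.rightRel Λ)) :
    coinvariantsAugmentation Λ ε (coinvariantsBasis Λ b (i, x)) = (ε (b i) : ℤ) := by
  induction x using Quotient.inductionOn with
  | h γ =>
    rw [coinvariantsBasis_mk, coinvariantsAugmentation_mkQ, map_smul, single_smul_trivialModule]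

/-- A based free resolution that is finitely generated and non-trivial in degrees `≤ n` of an
infinite amenable group is cheaply weakly rebuildable. -/
theorem isCheapWeakRebuildable [Infinite Γ] {n : ℕ} (amenable : IsAmenable Γ)
    (X : BasedComplex.{u, u} (GroupRing Γ)) (hX : IsResolution X.complex)
    (hne : ∀ j, Nonempty (X.index j)) (hfin : ∀ j ≤ n, Finite (X.index j)) :
    X.IsCheapWeakRebuildable n := by
  classical
  obtain ⟨hex, ε, hε, hsurj⟩ := hX
  have hfin' : ∀ j : Fin n, Finite (X.index (j + 1)) := fun j => hfin _ (by omega)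
  have : Fintype (Σ j : Fin n, X.index (j + 1)) := Fintype.ofFinite _
  have := hfin 0 (Nat.zero_le n)
  have : Fintype (X.index 0) := Fintype.ofFinite _
  obtain ⟨K, hK1, hK⟩ : ∃ K : ℝ≥0, 1 ≤ K ∧ ∀ i, ((ε (X.basis 0 i) : ℤ).natAbs : ℝ≥0) ≤ K := by
    refine ⟨1 + ∑ i, ((ε (X.basis 0 i) : ℤ).natAbs : ℝ≥0), le_self_add, fun i => ?_⟩
    exact (Finset.single_le_sum (f := fun i => ((ε (X.basis 0 i) : ℤ).natAbs : ℝ≥0))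
      (fun _ _ => zero_le) (Finset.mem_univ i)).trans le_add_self
  obtain ⟨D, hD⟩ : ∃ D : ℝ≥0, ∀ j, j + 1 ≤ n → ∀ i (Λ : Subgroup Γ) (γ : Γ),
      l1Norm (coinvariantsBasis Λ (X.basis j)) ((coinvariantsKer Λ (X.complex.X j)).mkQ
        (MonoidAlgebra.single γ (1 : ℤ) •
          (X.complex.d (j + 1) j).hom (X.basis (j + 1) i))) ≤ D := by
    choose D hD using fun q : Σ j : Fin n, X.index (j + 1) => exists_l1Norm_mkQ_le (X.basis q.1)
      ((X.complex.d (q.1 + 1) q.1).hom (X.basis (q.1 + 1) q.2))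
    refine ⟨∑ q, D q, fun j hj i Λ γ => (hD ⟨⟨j, hj⟩, i⟩ Λ γ).trans ?_⟩
    exact Finset.single_le_sum (f := D) (fun _ _ => zero_le) (Finset.mem_univ _)
  obtain ⟨S, hS⟩ : ∃ S : Finset Γ, ∀ j, j + 1 ≤ n → ∀ i,
      (X.complex.d (j + 1) j).hom (X.basis (j + 1) i) ∈ translateSpan (X.basis j) S := by
    choose S hS using fun q : Σ j : Fin n, X.index (j + 1) => exists_mem_translateSpan
      (X.basis q.1) ((X.complex.d (q.1 + 1) q.1).hom (X.basis (q.1 + 1) q.2))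
    refine ⟨Finset.univ.biUnion S, fun j hj i => ?_⟩
    exact translateSpan_mono _ (Finset.subset_biUnion_of_mem S (Finset.mem_univ _))
      (hS ⟨⟨j, hj⟩, i⟩)
  obtain ⟨W, hSW, hW, hWmono⟩ := exists_iterated_products S
  -- `K` will bound ξ and `K * D` the differential; the 1 gives κ ≥ 1, which suffices for the rank
  -- estimate. The factor T^κ is used only through T^κ ≥ 1.
  let κ : ℝ := 1 + K + K * D
  have hκ : (1 : ℝ) ≤ κ := by
    have : (0 : ℝ) ≤ K + K * D := by positivity
    simp only [κ]
    linarith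
  refine ⟨fun j hj => ?_, κ, hκ, fun T hT Λ => ?_⟩
  · have := hfin j hj
    exact Module.Finite.of_basis (X.basis j)
  have hTpos : 0 < T := one_pos.trans_le hT
  have hbound : ∀ C : ℝ≥0, (C : ℝ) ≤ κ → (C : ℝ≥0∞) ≤ ENNReal.ofReal (Real.exp κ * T ^ κ) := by
    intro C hC
    rw [← ENNReal.ofReal_coe_nnreal]
    refine ENNReal.ofReal_le_ofReal (hC.trans ?_)
    calc κ ≤ Real.exp κ := by linarith [Real.add_one_le_exp κ]
      _ ≤ Real.exp κ * T ^ κ := le_mul_of_one_le_right (Real.exp_pos κ).le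
        (Real.one_le_rpow hT (zero_le_one.trans hκ))
  -- Half of the allowed rank T⁻¹ rk goes to the bad basis elements, the other half to the extra
  -- generator, whence index at least 2T.
  obtain ⟨i₁, hi₁⟩ := Λ.eventually_exists_section amenable (W n)
    (ε := (2 * T)⁻¹) (by positivity)
  obtain ⟨i₂, hi₂⟩ := Λ.eventually_le_card ⌈2 * T⌉₊
  refine ⟨max i₁ i₂, fun i hi => ?_⟩
  obtain ⟨ℓ, hℓ, hcard⟩ := hi₁ i ((le_max_left _ _).trans hi)
  have hcardQ := hi₂ i ((le_max_right _ _).trans hi)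
  let Q := Quotient (QuotientGroup.rightRel (Λ.subgroup i))
  obtain ⟨c, hset, hcoeff_zero, hcoeff_succ⟩ :=
    exists_collapse hSW hW hℓ hS ε hex hε hsurj
  have hindex : ∀ j ≤ n, Finite ((X.coinvariants (Λ.subgroup i)).index j) := by
    intro j hj
    have := hfin j hj
    exact inferInstanceAs (Finite (X.index j × Q))
  have hcoeff : ∀ j, ∀ p ∈ c.set j,
      ((c.coeff j ((X.coinvariants (Λ.subgroup i)).basis j p)).natAbs : ℝ≥0) ≤ K := by
    rintro (_ | j) ⟨k, x⟩ -
    · rw [hcoeff_zero]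
      refine le_trans (le_of_eq ?_) (hK k)
      exact congrArg (fun z : ℤ => (z.natAbs : ℝ≥0)) (coinvariantsAugmentation_basis (X.basis 0) ε k x)
    · rw [hcoeff_succ]
      simp
  refine ⟨c.complex, c.homotopyRetract, ?_, fun j hj => c.finite_complex (hindex j hj), ?_, ?_, ?_⟩
  · intro j hj
    have := hindex j hj
    exact Module.Finite.of_basis ((X.coinvariants (Λ.subgroup i)).basis j)
  · intro j hj
    have := hfin j hj
    rw [c.finrank_complex (hindex j hj),
      Module.finrank_eq_nat_card_basis ((X.coinvariants (Λ.subgroup i)).basis j)]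
    -- As `W j` ⊆ `W n`, uncollapsed basis elements of degree j ≤ n lie over points that are bad for
    -- `W n`.
    have h1 : Nat.card ↥(c.set j)ᶜ ≤ Nat.card (X.index j) *
        Nat.card {x : Q // ∃ w ∈ W n, ℓ (Quotient.mk _ (ℓ x * w)) ≠ ℓ x * w} := by
      rw [← Nat.card_prod]
      refine Nat.card_le_card_of_injective (fun p : ↥(c.set j)ᶜ => (p.1.1, ⟨p.1.2, ?_⟩)) ?_
      · by_contra hcon
        push Not at hcon
        exact p.2 ((congrFun hset j).ge ⟨hj, fun w hw => hcon w (hWmono hj hw)⟩)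
      · rintro ⟨⟨a, b⟩, h⟩ ⟨⟨a', b'⟩, h'⟩ hab
        simp only [Prod.mk.injEq, Subtype.mk.injEq] at hab
        obtain ⟨rfl, rfl⟩ := hab
        rfl
    have h2 : Nat.card ((X.coinvariants (Λ.subgroup i)).index j) =
        Nat.card (X.index j) * Nat.card Q := Nat.card_prod _ _
    have h3 : (1 : ℝ) ≤ Nat.card (X.index j) := by
      have := hne j
      exact_mod_cast Nat.card_pos (α := X.index j)
    have h4 : 2 * T ≤ Nat.card Q := (Nat.le_ceil _).trans (by exact_mod_cast hcardQ)
    have h5 : (1 : ℝ) ≤ Nat.card (X.index j) * ((2 * T)⁻¹ * Nat.card Q) := by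
      refine one_le_mul_of_one_le_of_one_le h3 ?_
      rw [inv_mul_eq_div, one_le_div (by positivity)]
      exact h4
    rw [h2]
    push_cast
    calc (Nat.card ↥(c.set j)ᶜ : ℝ) + 1
        ≤ Nat.card (X.index j) * ((2 * T)⁻¹ * Nat.card Q) +
          Nat.card (X.index j) * ((2 * T)⁻¹ * Nat.card Q) := by
          refine add_le_add ?_ h5
          calc (Nat.card ↥(c.set j)ᶜ : ℝ) ≤ Nat.card (X.index j) *
              Nat.card {x : Q // ∃ w ∈ W n, ℓ (Quotient.mk _ (ℓ x * w)) ≠ ℓ x * w} := by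
                exact_mod_cast h1
            _ ≤ _ := by gcongr
      _ = 1 * T⁻¹ * (Nat.card (X.index j) * Nat.card Q) := by
          field_simp
          ring
      _ ≤ κ * T⁻¹ * (Nat.card (X.index j) * Nat.card Q) := by gcongr
  · intro j hj
    refine (c.l1OpNorm_d_le hK1 (hcoeff j) ?_).trans (hbound (K * D) ?_)
    · rintro ⟨k, x⟩
      induction x using Quotient.inductionOn with
      | h γ =>
        rw [coinvariants_d_basis]
        exact hD j hj k _ γ
    · simp only [κ, NNReal.coe_mul]
      linarith [K.coe_nonneg]
  · intro j hj
    refine (c.l1OpNorm_toFun_le hK1 (hcoeff j)).trans (hbound K ?_)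
    have : (0 : ℝ) ≤ K * D := by positivity
    simp only [κ]
    linarith

end

end CheapRebuilding

end

theorem mainTheorem4 {Γ : Type u} [Group Γ] (n : ℕ)
    (residuallyFinite : CheapRebuilding.IsResiduallyFinite Γ) (infinite : Infinite Γ)
    (amenable : CheapRebuilding.IsAmenable Γ) (typeFP : CheapRebuilding.IsTypeFP n Γ) :
    CheapRebuilding.CWR n Γ := by
  obtain ⟨X, hX, hne, hfin⟩ := typeFP.exists_resolution
  exact ⟨residuallyFinite, X, hX, CheapRebuilding.isCheapWeakRebuildable amenable X hX hne hfin⟩
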